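/- Let $\mathfrak g$ be a finite-dimensional simple Lie algebra over $\mathbb C$ with Cartan subalgebra $\mathfrak h$ and a fixed choice of positive roots, and let $\mathfrak n_+$ be the sum of the positive root spaces. Let $\hat{\mathfrak g}=\mathfrak g\otimes\mathbb C[t,t^{-1}]\oplus\mathbb CK$ and $\tilde{\mathfrak g}=\hat{\mathfrak g}\oplus\mathbb Cd$, with $K$ central, $[x\otimes t^p,y\otimes t^q]=[x,y]\otimes t^{p+q}+p\,\delta_{p+q,0}(x|y)K$ and $[d,x\otimes t^p]=p\,x\otimes t^p$, where $(\cdot|\cdot)$ is the Killing form of $\mathfrak g$. Let $a=(a_1,\dots,a_m)\in\mathbb C^m$ have nonzero, pairwise distinct entries, and let $\lambda=(\lambda_1,\dots,\lambda_m)\in(\mathfrak h^*)^m$ with $\lambda\neq 0$. For each $i$ let $V(\lambda_i)$ be the irreducible highest weight $\mathfrak g$-module of highest weight $\lambda_i$ (irreducible and generated by a nonzero vector $v$ with $hv=\lambda_i(h)v$ for $h\in\mathfrak h$ and $\mathfrak n_+v=0$). Let $E(\lambda,a)=V(\lambda_1)\otimes\cdots\otimes V(\lambda_m)$ be the $\hat{\mathfrak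 g}$-module on which $K$ acts as $0$ and $(x\otimes t^k)(v_1\otimes\cdots\otimes v_m)=\sum_{i=1}^m a_i^k\,v_1\otimes\cdots\otimes xv_i\otimes\cdots\otimes v_m$. For a $\hat{\mathfrak g}$-module $M$ write $M[d]=\operatorname{Ind}_{\hat{\mathfrak g}}^{\tilde{\mathfrak g}}M=U(\tilde{\mathfrak g})\otimes_{U(\hat{\mathfrak g})}M$. Let $L$ be a $\hat{\mathfrak g}$-module such that for every $v\in L$ we have $(\mathfrak g\otimes t^k\mathbb C[t])v=0$ for all sufficiently large $k\in\mathbb N$. Then every $\tilde{\mathfrak g}$-submodule of $(E(\lambda,a)\otimes L)[d]$ is of the form $(E(\lambda,a)\otimes N)[d]$ for some $\hat{\mathfrak g}$-submodule $N$ of $L$. -/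

import Mathlib

open scoped TensorProduct

noncomputable section

attribute [local instance 100] LieRing.ofAssociativeRing

namespace AffineLie

universe u v w w'

/-- The homomorphism `R → Der K`, `z ↦ z D`, from the one-dimensional abelian Lie algebra `R`
determined by a derivation `D` of `K`. -/
def derivationHom {R : Type v} {K : Type u} [CommRing R] [LieRing K] [LieAlgebra R K]
    (D : LieDerivation R K K) : R →ₗ⁅R⁆ LieDerivation R K K where
  toFun z := z • D
  map_add' a b := add_smul a b D
  map_smul' a b := mul_smul a b D
  map_lie' {a b} := by
    rw [LieRing.of_associative_ring_bracket, mul_comm, sub_self, zero_smul, smul_lie]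
    refine (?_ : a • ⁅D, b • D⁆ = 0).symm
    have h : ⁅D, b • D⁆ = b • ⁅D, D⁆ := lie_smul b D D
    rw [h, lie_self, smul_zero, smul_zero]

/-! ### Affine Lie algebras -/

section Affine

variable (𝔤 : Type u) [LieRing 𝔤] [LieAlgebra ℂ 𝔤]

/-- The loop algebra `ℂ[t, t⁻¹] ⊗ 𝔤`. -/
abbrev Loop : Type u := LieAlgebra.loopAlgebra ℂ ℤ 𝔤

/-- The 2-cocycle `(x ⊗ t^m, y ⊗ t^n) ↦ m δ_{m+n,0} (x|y)` on the loop algebra, where `(x|y)` is the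
Killing form. Mathlib's cocycle attached to a form `Φ` is `(x ⊗ t^m, y ⊗ t^n) ↦ n δ_{m+n,0} Φ x y`
(the residue of `f dg`), hence the sign. -/
def cocycle : LieModule.Cohomology.twoCocycle ℂ (Loop 𝔤) (TrivialLieModule ℂ (Loop 𝔤) ℂ) :=
  LieAlgebra.LoopAlgebra.twoCocycleOfBilinear ℂ ℤ 𝔤 (-killingForm ℂ 𝔤)
    (fun x y z => by
      have h := LieModule.traceForm_lieInvariant ℂ 𝔤 𝔤 x y z
      simpa [killingForm] using congrArg Neg.neg h)
    ⟨fun x y => by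
      simpa using LieModule.traceForm_comm ℂ 𝔤 𝔤 x y⟩

/-- The Lie algebra `ĝ = 𝔤 ⊗ ℂ[t, t⁻¹] ⊕ ℂ K`, with `K` central and
`[x ⊗ t^m, y ⊗ t^n] = [x, y] ⊗ t^(m+n) + m δ_{m+n,0} (x|y) K`. -/
def Hat : Type u := LieAlgebra.ofTwoCocycle (cocycle 𝔤)

instance : LieRing (Hat 𝔤) := inferInstanceAs (LieRing (LieAlgebra.ofTwoCocycle (cocycle 𝔤)))

instance : LieAlgebra ℂ (Hat 𝔤) :=
  inferInstanceAs (LieAlgebra ℂ (LieAlgebra.ofTwoCocycle (cocycle 𝔤)))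

variable {𝔤}

/-- The element `f + c K` of `ĝ`. -/
def Hat.mk (f : Loop 𝔤) (c : ℂ) : Hat 𝔤 := ⟨(f, c)⟩

/-- The element `x ⊗ t^k` of `ĝ`. -/
def Hat.single (k : ℤ) (x : 𝔤) : Hat 𝔤 := Hat.mk (AddMonoidAlgebra.single k 1 ⊗ₜ[ℂ] x) 0

variable (𝔤)

/-- The subspace `𝔤 ⊗ t^k ℂ[t]` of `ĝ`. -/
def Hat.current (k : ℕ) : Submodule ℂ (Hat 𝔤) :=
  Submodule.span ℂ {y | ∃ (j : ℕ) (x : 𝔤), k ≤ j ∧ y = Hat.single (j : ℤ) x}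

/-- The linear map `t d/dt : x ⊗ t^k ↦ k x ⊗ t^k` on the loop algebra. -/
def loopDegree : Loop 𝔤 →ₗ[ℂ] Loop 𝔤 :=
  (LieAlgebra.LoopAlgebra.toFinsupp ℂ ℤ 𝔤).symm.toLinearMap ∘ₗ
    Finsupp.lsum ℂ (fun k : ℤ => (k : ℂ) • Finsupp.lsingle (R := ℂ) (M := 𝔤) k) ∘ₗ
    (LieAlgebra.LoopAlgebra.toFinsupp ℂ ℤ 𝔤).toLinearMap

theorem loopDegree_single_tmul (k : ℤ) (x : 𝔤) :
    loopDegree 𝔤 (AddMonoidAlgebra.single k 1 ⊗ₜ[ℂ] x) =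
      (k : ℂ) • (AddMonoidAlgebra.single k 1 ⊗ₜ[ℂ] x) := by
  rw [loopDegree, LinearMap.comp_apply, LinearMap.comp_apply, LinearEquiv.coe_coe,
    LinearEquiv.coe_coe, LieAlgebra.LoopAlgebra.toFinsupp_single_tmul, Finsupp.lsum_single,
    LinearMap.smul_apply, map_smul, Finsupp.lsingle_apply,
    LieAlgebra.LoopAlgebra.toFinsupp_symm_single]

theorem loop_induction {p : Loop 𝔤 → Prop} (h0 : p 0) (hadd : ∀ f g, p f → p g → p (f + g))
    (hs : ∀ (k : ℤ) (x : 𝔤), p (AddMonoidAlgebra.single k 1 ⊗ₜ[ℂ] x)) (f : Loop 𝔤) : p f := by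
  obtain ⟨f, rfl⟩ := (LieAlgebra.LoopAlgebra.toFinsupp ℂ ℤ 𝔤).symm.surjective f
  induction f using Finsupp.induction_linear with
  | zero => rw [map_zero]; exact h0
  | add f g hf hg => rw [map_add]; exact hadd _ _ hf hg
  | single k x => rw [LieAlgebra.LoopAlgebra.toFinsupp_symm_single]; exact hs k x

theorem loopDegree_lie (f g : Loop 𝔤) :
    loopDegree 𝔤 ⁅f, g⁆ = ⁅loopDegree 𝔤 f, g⁆ + ⁅f, loopDegree 𝔤 g⁆ := by
  have hadd (a b c : Loop 𝔤) : ⁅a + b, c⁆ = ⁅a, c⁆ + ⁅b, c⁆ := add_lie a b c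
  have hadd' (a b c : Loop 𝔤) : ⁅a, b + c⁆ = ⁅a, b⁆ + ⁅a, c⁆ := lie_add a b c
  have hz (a : Loop 𝔤) : ⁅(0 : Loop 𝔤), a⁆ = 0 := zero_lie a
  have hz' (a : Loop 𝔤) : ⁅a, (0 : Loop 𝔤)⁆ = 0 := lie_zero a
  have hc (c : ℂ) (a b : Loop 𝔤) : ⁅c • a, b⁆ = c • ⁅a, b⁆ := smul_lie c a b
  have hc' (c : ℂ) (a b : Loop 𝔤) : ⁅a, c • b⁆ = c • ⁅a, b⁆ := lie_smul c a b
  refine loop_induction 𝔤 (p := fun f => loopDegree 𝔤 ⁅f, g⁆ =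
    ⁅loopDegree 𝔤 f, g⁆ + ⁅f, loopDegree 𝔤 g⁆) ?_ ?_ ?_ f
  · simp only [hz, map_zero, add_zero]
  · intro f f' hf hf'
    simp only [hadd, map_add, hf, hf']
    abel
  intro k x
  refine loop_induction 𝔤 (p := fun g => loopDegree 𝔤 ⁅AddMonoidAlgebra.single k 1 ⊗ₜ[ℂ] x, g⁆ =
    ⁅loopDegree 𝔤 (AddMonoidAlgebra.single k 1 ⊗ₜ[ℂ] x), g⁆ +
      ⁅AddMonoidAlgebra.single k 1 ⊗ₜ[ℂ] x, loopDegree 𝔤 g⁆) ?_ ?_ ?_ g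
  · simp only [hz', map_zero, add_zero]
  · intro f f' hf hf'
    simp only [hadd', map_add, hf, hf']
    abel
  intro l y
  simp only [loopDegree_single_tmul, hc, hc', LieAlgebra.ExtendScalars.bracket_tmul,
    AddMonoidAlgebra.single_mul_single, mul_one, ← add_smul, Int.cast_add]

theorem residuePairing_single (Φ : LinearMap.BilinForm ℂ 𝔤) (k l : ℤ) (x y : 𝔤) :
    LieAlgebra.LoopAlgebra.residuePairing ℂ ℤ 𝔤 Φ (AddMonoidAlgebra.single k 1 ⊗ₜ[ℂ] x)
      (AddMonoidAlgebra.single l 1 ⊗ₜ[ℂ] y) = if k + l = 0 then (l : ℂ) * Φ x y else 0 := by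
  simp only [LieAlgebra.LoopAlgebra.residuePairing_apply_apply,
    LieAlgebra.LoopAlgebra.toFinsupp_single_tmul]
  rw [Finsupp.sum_single_index (by simp)]
  by_cases h : k + l = 0
  · obtain rfl : k = -l := by omega
    simp
  · have : k ≠ -l := by omega
    simp [this, h]

theorem residuePairing_loopDegree (Φ : LinearMap.BilinForm ℂ 𝔤) (f g : Loop 𝔤) :
    LieAlgebra.LoopAlgebra.residuePairing ℂ ℤ 𝔤 Φ (loopDegree 𝔤 f) g +
      LieAlgebra.LoopAlgebra.residuePairing ℂ ℤ 𝔤 Φ f (loopDegree 𝔤 g) = 0 := by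
  refine loop_induction 𝔤 (p := fun f =>
    LieAlgebra.LoopAlgebra.residuePairing ℂ ℤ 𝔤 Φ (loopDegree 𝔤 f) g +
      LieAlgebra.LoopAlgebra.residuePairing ℂ ℤ 𝔤 Φ f (loopDegree 𝔤 g) = 0) ?_ ?_ ?_ f
  · simp only [map_zero, LinearMap.zero_apply, add_zero]
  · intro f f' hf hf'
    simp only [map_add, LinearMap.add_apply]
    linear_combination hf + hf'
  intro k x
  refine loop_induction 𝔤 (p := fun g => LieAlgebra.LoopAlgebra.residuePairing ℂ ℤ 𝔤 Φ
      (loopDegree 𝔤 (AddMonoidAlgebra.single k 1 ⊗ₜ[ℂ] x)) g +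
    LieAlgebra.LoopAlgebra.residuePairing ℂ ℤ 𝔤 Φ (AddMonoidAlgebra.single k 1 ⊗ₜ[ℂ] x)
      (loopDegree 𝔤 g) = 0) ?_ ?_ ?_ g
  · simp only [map_zero, add_zero]
  · intro f f' hf hf'
    simp only [map_add]
    linear_combination hf + hf'
  intro l y
  simp only [loopDegree_single_tmul, map_smul, LinearMap.smul_apply, residuePairing_single,
    smul_eq_mul]
  split_ifs with h
  · have h' : (k : ℂ) + l = 0 := by exact_mod_cast h
    linear_combination ((l : ℂ) * Φ x y) * h'
  · simp

variable {𝔤} in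
theorem Hat.lie_def (y z : Hat 𝔤) : ⁅y, z⁆ = Hat.mk ⁅y.carrier.1, z.carrier.1⁆
    (LieAlgebra.LoopAlgebra.residuePairing ℂ ℤ 𝔤 (-killingForm ℂ 𝔤)
      y.carrier.1 z.carrier.1) := by
  refine (LieAlgebra.bracket_ofTwoCocycle (c := cocycle 𝔤) y z).trans ?_
  simp only [LieModule.IsTrivial.trivial, add_zero, sub_zero]
  rfl

/-- The derivation `d = t d/dt` of `ĝ`, which kills `K`. -/
def degree : LieDerivation ℂ (Hat 𝔤) (Hat 𝔤) where
  toFun y := Hat.mk (loopDegree 𝔤 y.carrier.1) 0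
  map_add' y z := by
    change Hat.mk (loopDegree 𝔤 (y.carrier.1 + z.carrier.1)) 0 =
      Hat.mk (loopDegree 𝔤 y.carrier.1 + loopDegree 𝔤 z.carrier.1) (0 + 0)
    rw [map_add, add_zero]
  map_smul' c y := by
    change Hat.mk (loopDegree 𝔤 (c • y.carrier.1)) 0 =
      Hat.mk (c • loopDegree 𝔤 y.carrier.1) (c • 0)
    rw [map_smul, smul_zero]
  leibniz' y z := by
    change Hat.mk (loopDegree 𝔤 ⁅y, z⁆.carrier.1) 0 = ⁅y, Hat.mk (loopDegree 𝔤 z.carrier.1) 0⁆ -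
      ⁅z, Hat.mk (loopDegree 𝔤 y.carrier.1) 0⁆
    rw [← lie_skew z, sub_neg_eq_add]
    simp only [Hat.lie_def]
    change Hat.mk (loopDegree 𝔤 ⁅y.carrier.1, z.carrier.1⁆) 0 =
      Hat.mk (⁅y.carrier.1, loopDegree 𝔤 z.carrier.1⁆ + ⁅loopDegree 𝔤 y.carrier.1, z.carrier.1⁆)
        (LieAlgebra.LoopAlgebra.residuePairing ℂ ℤ 𝔤 (-killingForm ℂ 𝔤)
            y.carrier.1 (loopDegree 𝔤 z.carrier.1) +
          LieAlgebra.LoopAlgebra.residuePairing ℂ ℤ 𝔤 (-killingForm ℂ 𝔤)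
            (loopDegree 𝔤 y.carrier.1) z.carrier.1)
    rw [loopDegree_lie, add_comm, add_comm (LieAlgebra.LoopAlgebra.residuePairing _ _ _ _ _ _),
      residuePairing_loopDegree]

/-- The Lie algebra map `ℂ → Der ĝ`, `z ↦ z d`. -/
def degreeHom : ℂ →ₗ⁅ℂ⁆ LieDerivation ℂ (Hat 𝔤) (Hat 𝔤) := derivationHom (degree 𝔤)

/-- The untwisted affine Kac-Moody algebra `g̃ = ĝ ⊕ ℂ d`, with `[d, x ⊗ t^m] = m x ⊗ t^m` and
`[d, K] = 0`. -/
abbrev Tilde : Type u := LieAlgebra.SemiDirectSum (Hat 𝔤) ℂ (degreeHom 𝔤)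

/-- The inclusion of `ĝ` into `g̃`. -/
abbrev hatToTilde : Hat 𝔤 →ₗ⁅ℂ⁆ Tilde 𝔤 := LieAlgebra.SemiDirectSum.inl (degreeHom 𝔤)

end Affine

/-! ### Induced modules -/

section Induction

variable {𝔨 : Type u} {𝔩 : Type v} [LieRing 𝔨] [LieAlgebra ℂ 𝔨] [LieRing 𝔩] [LieAlgebra ℂ 𝔩]
  (f : 𝔨 →ₗ⁅ℂ⁆ 𝔩)
  (M : Type w) [AddCommGroup M] [Module ℂ M] [LieRingModule 𝔨 M] [LieModule ℂ 𝔨 M]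
  {M' : Type w'} [AddCommGroup M'] [Module ℂ M'] [LieRingModule 𝔨 M'] [LieModule ℂ 𝔨 M']

/-- The submodule of `U(𝔩) ⊗_ℂ M` generated by `u x ⊗ m - u ⊗ x m` for `x ∈ 𝔨`. -/
def indRel : Submodule (UniversalEnvelopingAlgebra ℂ 𝔩) (UniversalEnvelopingAlgebra ℂ 𝔩 ⊗[ℂ] M) :=
  Submodule.span _ {z | ∃ (u : UniversalEnvelopingAlgebra ℂ 𝔩) (x : 𝔨) (m : M),
    z = (u * UniversalEnvelopingAlgebra.ι ℂ (f x)) ⊗ₜ[ℂ] m - u ⊗ₜ[ℂ] ⁅x, m⁆}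

/-- The induced module `Ind M = U(𝔩) ⊗_{U(𝔨)} M`, for a Lie algebra map `f : 𝔨 → 𝔩`. -/
def Ind : Type (max v w) := (UniversalEnvelopingAlgebra ℂ 𝔩 ⊗[ℂ] M) ⧸ indRel f M

instance : AddCommGroup (Ind f M) :=
  inferInstanceAs (AddCommGroup ((UniversalEnvelopingAlgebra ℂ 𝔩 ⊗[ℂ] M) ⧸ indRel f M))

instance : Module (UniversalEnvelopingAlgebra ℂ 𝔩) (Ind f M) :=
  inferInstanceAs (Module _ ((UniversalEnvelopingAlgebra ℂ 𝔩 ⊗[ℂ] M) ⧸ indRel f M))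

instance : Module ℂ (Ind f M) :=
  inferInstanceAs (Module ℂ ((UniversalEnvelopingAlgebra ℂ 𝔩 ⊗[ℂ] M) ⧸ indRel f M))

instance : IsScalarTower ℂ (UniversalEnvelopingAlgebra ℂ 𝔩) (Ind f M) :=
  inferInstanceAs (IsScalarTower ℂ (UniversalEnvelopingAlgebra ℂ 𝔩)
    ((UniversalEnvelopingAlgebra ℂ 𝔩 ⊗[ℂ] M) ⧸ indRel f M))

/-- `x ∈ 𝔩` acts on `Ind M` as the element `x` of `U(𝔩)`. -/
instance : LieRingModule 𝔩 (Ind f M) where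
  bracket x z := UniversalEnvelopingAlgebra.ι ℂ x • z
  add_lie x y z := by simp [add_smul]
  lie_add x y z := by simp
  leibniz_lie x y z := by simp [LieRing.of_associative_ring_bracket, sub_smul, mul_smul]

instance : LieModule ℂ 𝔩 (Ind f M) where
  smul_lie c x z := by
    change UniversalEnvelopingAlgebra.ι ℂ (c • x) • z = c • (UniversalEnvelopingAlgebra.ι ℂ x • z)
    rw [map_smul, smul_assoc]
  lie_smul c x z := smul_algebra_smul_comm c (UniversalEnvelopingAlgebra.ι ℂ x) z

variable {M}

/-- The map `Ind M → Ind M'`, `u ⊗ m ↦ u ⊗ φ m`, induced by a `𝔨`-module map `φ : M → M'`, as a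
map of `U(𝔩)`-modules. -/
def Ind.mapLinear (φ : M →ₗ⁅ℂ,𝔨⁆ M') :
    Ind f M →ₗ[UniversalEnvelopingAlgebra ℂ 𝔩] Ind f M' :=
  Submodule.mapQ (indRel f M) (indRel f M')
    (TensorProduct.AlgebraTensorModule.map
      (LinearMap.id : UniversalEnvelopingAlgebra ℂ 𝔩 →ₗ[UniversalEnvelopingAlgebra ℂ 𝔩] _)
      (φ : M →ₗ[ℂ] M')) (by
        rw [indRel, Submodule.span_le]
        rintro _ ⟨u, x, m, rfl⟩
        refine Submodule.subset_span ⟨u, x, φ m, ?_⟩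
        simp)

/-- The map `Ind M → Ind M'`, `u ⊗ m ↦ u ⊗ φ m`, induced by a `𝔨`-module map `φ : M → M'`. -/
def Ind.map (φ : M →ₗ⁅ℂ,𝔨⁆ M') : Ind f M →ₗ⁅ℂ,𝔩⁆ Ind f M' where
  toLinearMap := (Ind.mapLinear f φ).restrictScalars ℂ
  map_lie' {x z} := (Ind.mapLinear f φ).map_smul (UniversalEnvelopingAlgebra.ι ℂ x) z

/-- For a `𝔨`-submodule `P` of `M`, the `𝔩`-submodule `Ind P` of `Ind M`, that is, the image of
`Ind P → Ind M`. -/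
def Ind.submodule (P : LieSubmodule ℂ 𝔨 M) : LieSubmodule ℂ 𝔩 (Ind f M) :=
  (Ind.map f P.incl).range

end Induction

/-! ### Evaluation modules -/

section Evaluation

variable {𝔤 : Type u} [LieRing 𝔤] [LieAlgebra ℂ 𝔤]

/-- Evaluation `p ↦ p(a)` of Laurent polynomials at a nonzero complex number `a`. -/
def evalLaurent (a : ℂˣ) : LaurentPolynomial ℂ →ₐ[ℂ] ℂ :=
  { LaurentPolynomial.eval₂ (RingHom.id ℂ) a with
    commutes' := fun r => by
      change LaurentPolynomial.eval₂ (RingHom.id ℂ) a (algebraMap ℂ (LaurentPolynomial ℂ) r) = r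
      exact LaurentPolynomial.eval₂_C (RingHom.id ℂ) a r }

/-- The linear map `𝔤 ⊗ ℂ[t, t⁻¹] → 𝔤`, `x ⊗ p ↦ p(a) x`. -/
def evalLoop (a : ℂˣ) : Loop 𝔤 →ₗ[ℂ] 𝔤 :=
  (TensorProduct.lid ℂ 𝔤).toLinearMap ∘ₗ
    TensorProduct.map (evalLaurent a).toLinearMap LinearMap.id

theorem evalLoop_tmul (a : ℂˣ) (p : LaurentPolynomial ℂ) (x : 𝔤) :
    evalLoop a (p ⊗ₜ[ℂ] x) = evalLaurent a p • x := rfl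

theorem evalLoop_lie (a : ℂˣ) (f g : Loop 𝔤) : evalLoop a ⁅f, g⁆ = ⁅evalLoop a f, evalLoop a g⁆ := by
  have hadd (a b c : Loop 𝔤) : ⁅a + b, c⁆ = ⁅a, c⁆ + ⁅b, c⁆ := add_lie a b c
  have hadd' (a b c : Loop 𝔤) : ⁅a, b + c⁆ = ⁅a, b⁆ + ⁅a, c⁆ := lie_add a b c
  have hz (a : Loop 𝔤) : ⁅(0 : Loop 𝔤), a⁆ = 0 := zero_lie a
  have hz' (a : Loop 𝔤) : ⁅a, (0 : Loop 𝔤)⁆ = 0 := lie_zero a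
  induction f using TensorProduct.induction_on with
  | zero => rw [hz, map_zero, zero_lie]
  | add f f' hf hf' => rw [hadd, map_add, hf, hf', map_add, add_lie]
  | tmul p x =>
    induction g using TensorProduct.induction_on with
    | zero => rw [hz', map_zero, lie_zero]
    | add f f' hf hf' => rw [hadd', map_add, hf, hf', map_add, lie_add]
    | tmul q y =>
      rw [LieAlgebra.ExtendScalars.bracket_tmul, evalLoop_tmul, evalLoop_tmul, evalLoop_tmul,
        smul_lie, lie_smul, smul_smul, map_mul]

/-- The Lie algebra homomorphism `ĝ → 𝔤`, `x ⊗ p ↦ p(a) x`, `K ↦ 0`. -/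
def evalHat (a : ℂˣ) : Hat 𝔤 →ₗ⁅ℂ⁆ 𝔤 where
  toFun y := evalLoop a y.carrier.1
  map_add' y z := map_add (evalLoop a) y.carrier.1 z.carrier.1
  map_smul' c y := map_smul (evalLoop a) c y.carrier.1
  map_lie' {y z} := by
    rw [Hat.lie_def]
    exact evalLoop_lie a y.carrier.1 z.carrier.1

variable {m : ℕ} (a : Fin m → ℂˣ) (V : Fin m → Type v) [∀ i, AddCommGroup (V i)]
  [∀ i, Module ℂ (V i)]

/-- The evaluation module `V_1 ⊗ ⋯ ⊗ V_m` at the point `a = (a_1, …, a_m)`, as a vector space. -/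
@[nolint unusedArguments]
def Eval (_a : Fin m → ℂˣ) (V : Fin m → Type v) [∀ i, AddCommGroup (V i)]
    [∀ i, Module ℂ (V i)] : Type v := ⨂[ℂ] i, V i

instance : AddCommGroup (Eval a V) := inferInstanceAs (AddCommGroup (⨂[ℂ] i, V i))

instance : Module ℂ (Eval a V) := inferInstanceAs (Module ℂ (⨂[ℂ] i, V i))

/-- The endomorphism `v_1 ⊗ ⋯ ⊗ v_m ↦ v_1 ⊗ ⋯ ⊗ φ v_i ⊗ ⋯ ⊗ v_m` of `V_1 ⊗ ⋯ ⊗ V_m`. -/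
def actAt (i : Fin m) (φ : Module.End ℂ (V i)) : Module.End ℂ (⨂[ℂ] i, V i) :=
  PiTensorProduct.map (Function.update (fun _ => LinearMap.id) i φ)

variable {V} in
theorem actAt_tprod (i : Fin m) (φ : Module.End ℂ (V i)) (x : ∀ i, V i) :
    actAt V i φ (PiTensorProduct.tprod ℂ x) =
      PiTensorProduct.tprod ℂ (Function.update x i (φ (x i))) := by
  rw [actAt, PiTensorProduct.map_tprod]
  congr 1
  ext j
  by_cases h : j = i
  · subst h; simp
  · simp [h]

theorem actAt_comm (i j : Fin m) (φ : Module.End ℂ (V i)) (ψ : Module.End ℂ (V j)) (h : i ≠ j) :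
    actAt V i φ * actAt V j ψ = actAt V j ψ * actAt V i φ := by
  ext x
  simp only [LinearMap.compMultilinearMap_apply, Module.End.mul_apply, actAt_tprod,
    Function.update_of_ne h, Function.update_of_ne h.symm, Function.update_comm h]

theorem actAt_mul (i : Fin m) (φ ψ : Module.End ℂ (V i)) :
    actAt V i φ * actAt V i ψ = actAt V i (φ * ψ) := by
  ext x
  simp [Module.End.mul_apply, actAt_tprod]

theorem actAt_add (i : Fin m) (φ ψ : Module.End ℂ (V i)) :
    actAt V i (φ + ψ) = actAt V i φ + actAt V i ψ :=
  PiTensorProduct.map_update_add _ _ _ _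

theorem actAt_smul (i : Fin m) (c : ℂ) (φ : Module.End ℂ (V i)) :
    actAt V i (c • φ) = c • actAt V i φ :=
  PiTensorProduct.map_update_smul _ _ _ _

theorem actAt_sub (i : Fin m) (φ ψ : Module.End ℂ (V i)) :
    actAt V i (φ - ψ) = actAt V i φ - actAt V i ψ := by
  rw [eq_sub_iff_add_eq, ← actAt_add, sub_add_cancel]

variable [∀ i, LieRingModule 𝔤 (V i)] [∀ i, LieModule ℂ 𝔤 (V i)]

/-- The action of `ĝ` on the evaluation module: `K` acts as zero and
`(x ⊗ t^k) (v_1 ⊗ ⋯ ⊗ v_m) = ∑ i, a_i^k v_1 ⊗ ⋯ ⊗ x v_i ⊗ ⋯ ⊗ v_m`. -/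
def evalAction (y : Hat 𝔤) : Module.End ℂ (⨂[ℂ] i, V i) :=
  ∑ i, actAt V i (LieModule.toEnd ℂ 𝔤 (V i) (evalHat (a i) y))

theorem evalAction_add (y z : Hat 𝔤) :
    evalAction a V (y + z) = evalAction a V y + evalAction a V z := by
  simp only [evalAction, map_add, actAt_add, Finset.sum_add_distrib]

theorem evalAction_smul (c : ℂ) (y : Hat 𝔤) : evalAction a V (c • y) = c • evalAction a V y := by
  simp only [evalAction, map_smul, actAt_smul, Finset.smul_sum]

theorem evalAction_lie (y z : Hat 𝔤) : evalAction a V ⁅y, z⁆ =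
    evalAction a V y * evalAction a V z - evalAction a V z * evalAction a V y := by
  simp only [evalAction, Finset.sum_mul_sum]
  rw [Finset.sum_comm (γ := Fin m) (f := fun i j =>
    actAt V i (LieModule.toEnd ℂ 𝔤 (V i) (evalHat (a i) z)) * _), ← Finset.sum_sub_distrib]
  refine Finset.sum_congr rfl fun i _ => ?_
  rw [← Finset.sum_sub_distrib, Finset.sum_eq_single i]
  · rw [actAt_mul, actAt_mul, LieHom.map_lie, LieHom.map_lie, LieRing.of_associative_ring_bracket,
      actAt_sub]
  · intro j _ hj
    rw [actAt_comm V i j _ _ hj.symm, sub_self]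
  · simp

instance : LieRingModule (Hat 𝔤) (Eval a V) where
  bracket y v := evalAction a V y v
  add_lie y z v := LinearMap.congr_fun (evalAction_add a V y z) v
  lie_add y v w := map_add (evalAction a V y) v w
  leibniz_lie y z v := by
    change evalAction a V y (evalAction a V z v) =
      evalAction a V ⁅y, z⁆ v + evalAction a V z (evalAction a V y v)
    rw [evalAction_lie]
    exact (sub_add_cancel _ _).symm

instance : LieModule ℂ (Hat 𝔤) (Eval a V) where
  smul_lie c y v := LinearMap.congr_fun (evalAction_smul a V c y) v
  lie_smul c y v := map_smul (evalAction a V y) c v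

end Evaluation

/-- For a submodule `N` of `L`, the submodule `E ⊗ N` of `E ⊗ L`. -/
def tensorSubmodule {𝔨 : Type u} [LieRing 𝔨] [LieAlgebra ℂ 𝔨]
    (E : Type v) [AddCommGroup E] [Module ℂ E] [LieRingModule 𝔨 E] [LieModule ℂ 𝔨 E]
    {L : Type w} [AddCommGroup L] [Module ℂ L] [LieRingModule 𝔨 L] [LieModule ℂ 𝔨 L]
    (N : LieSubmodule ℂ 𝔨 L) : LieSubmodule ℂ 𝔨 (E ⊗[ℂ] L) :=
  (TensorProduct.LieModule.map (LieModuleHom.id : E →ₗ⁅ℂ,𝔨⁆ E) N.incl).range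

/-! ### Highest weight modules -/

section HighestWeight

variable {𝔤 : Type u} [LieRing 𝔤] [LieAlgebra ℂ 𝔤] [FiniteDimensional ℂ 𝔤]
  [LieAlgebra.IsKilling ℂ 𝔤] {𝔥 : LieSubalgebra ℂ 𝔤} [𝔥.IsCartanSubalgebra]
  (b : (LieAlgebra.IsKilling.rootSystem 𝔥).Base)
  (V : Type v) [AddCommGroup V] [Module ℂ V] [LieRingModule 𝔤 V] [LieModule ℂ 𝔤 V]

/-- `v` is a highest weight vector of weight `l`: it is nonzero, `h v = l(h) v` for `h ∈ 𝔥`, and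
`𝔫₊ v = 0`, where `𝔫₊` is the sum of the root spaces of the roots that are positive for `b`. -/
structure IsHighestWeightVector (l : Module.Dual ℂ 𝔥) {V : Type v} [AddCommGroup V] [Module ℂ V]
    [LieRingModule 𝔤 V] [LieModule ℂ 𝔤 V] (v : V) : Prop where
  ne_zero : v ≠ 0
  cartan : ∀ h : 𝔥, ⁅(h : 𝔤), v⁆ = l h • v
  positive : ∀ α : 𝔥.root, b.IsPos α → ∀ x ∈ LieAlgebra.rootSpace 𝔥 α.1, ⁅x, v⁆ = 0

/-- `V` is an irreducible highest weight module of highest weight `l`. -/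
structure IsIrreducibleHighestWeightModule (l : Module.Dual ℂ 𝔥) : Prop where
  irreducible : LieModule.IsIrreducible ℂ 𝔤 V
  generated : ∃ v : V, IsHighestWeightVector b l v ∧ LieSubmodule.lieSpan ℂ 𝔤 {v} = ⊤

end HighestWeight

end AffineLie

end

open AffineLie

open scoped TensorProduct

noncomputable section

attribute [local instance 100] LieRing.ofAssociativeRing

namespace AffineLie

universe u v w w'

/-! ### Independence of exponential polynomials -/

section ExponentialPolynomials

/-! Write `E` for the evaluation module. The vectors `f(d) ⊗ e ⊗ v` span `(E ⊗ L)[d]`, so a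
submodule `W` can be studied through its preimage `Z` in `E ⊗ (ℂ[X] ⊗ L)`, where `d` is
multiplication by `X`. Moving `x ⊗ t^k` past `f(d)` replaces `f(X)` by `f(X - k)`. For large `k` the
action on `v` vanishes, and what remains is `∑ i, ∑ j, a_i^k (-k)^j` times "`x` on the factor `V_i`,
the `j`-th divided derivative on `f`". The functions `k ↦ a_i^k k^j` are linearly independent, even
restricted to large `k`, because the `a_i` are distinct and nonzero. So each coefficient preserves
`Z` (`map_actAt_hasseDeriv_mem`).

The terms `j = 0` make `Z` stable under `𝔤` acting on each `V_i` separately. Density then gives `Z =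
E ⊗ Y` (`mem_span_tmul_rightPart`); since `V_i` may be infinite-dimensional, Schur's lemma is used
in its countable-dimensional form. The term `j = 1`, for an `h` with `λ_i(h) ≠ 0`, makes `Y` stable
under `d/dX`. As `Y` is also stable under `X`, it equals `ℂ[X] ⊗ N` (`one_tmul_mem_of_sum_mem`), and
`N` is the required submodule of `L`. -/

/-- The left shift on sequences. -/
def shift : Module.End ℂ (ℕ → ℂ) := LinearMap.funLeft ℂ ℂ Nat.succ

theorem shift_apply (f : ℕ → ℂ) (k : ℕ) : shift f k = f (k + 1) := rfl

theorem mem_maxGenEigenspace_of_sub {R M : Type*} [CommRing R] [AddCommGroup M] [Module R M]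
    {f : Module.End R M} {μ : R} {x : M} (h : f x - μ • x ∈ f.maxGenEigenspace μ) :
    x ∈ f.maxGenEigenspace μ := by
  rw [Module.End.mem_maxGenEigenspace] at h ⊢
  obtain ⟨n, hn⟩ := h
  exact ⟨n + 1, by rw [pow_succ, Module.End.mul_apply]; simpa using hn⟩

/-- By the binomial theorem, `shift - c` lowers the exponent `n`, so induction applies. The offset
`K` allows for relations that hold only from `K` on. -/
theorem pow_mul_pow_mem_maxGenEigenspace (c : ℂ) (K n : ℕ) :
    (fun k : ℕ => c ^ (k + K) * ((k + K : ℕ) : ℂ) ^ n) ∈ shift.maxGenEigenspace c := by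
  induction n using Nat.strong_induction_on with
  | _ n ih =>
  refine mem_maxGenEigenspace_of_sub ?_
  have h : shift (fun k : ℕ => c ^ (k + K) * ((k + K : ℕ) : ℂ) ^ n) -
      c • (fun k : ℕ => c ^ (k + K) * ((k + K : ℕ) : ℂ) ^ n) =
      ∑ j ∈ Finset.range n, (c * (n.choose j : ℂ)) •
        (fun k : ℕ => c ^ (k + K) * ((k + K : ℕ) : ℂ) ^ j) := by
    ext k
    have h1 : (((k + 1 + K : ℕ) : ℂ)) = ((k + K : ℕ) : ℂ) + 1 := by push_cast; ring
    simp only [Pi.sub_apply, Pi.smul_apply, shift_apply, Finset.sum_apply, smul_eq_mul]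
    rw [h1, add_pow, Finset.sum_range_succ]
    simp only [one_pow, mul_one, Nat.choose_self, Nat.cast_one]
    rw [mul_add, Finset.mul_sum, show k + 1 + K = k + K + 1 by ring, pow_succ]
    rw [add_sub_assoc, show c ^ (k + K) * c * ((k + K : ℕ) : ℂ) ^ n -
      c * (c ^ (k + K) * ((k + K : ℕ) : ℂ) ^ n) = 0 by ring, add_zero]
    exact Finset.sum_congr rfl fun j _ => by ring
  rw [h]
  exact Submodule.sum_mem _ fun j hj => Submodule.smul_mem _ _ (ih j (Finset.mem_range.1 hj))

/-- Generalized eigenspaces of the shift for distinct eigenvalues are independent, so each summand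
vanishes separately. Since `a i ≠ 0`, each `P i` then has infinitely many roots. -/
theorem eq_zero_of_sum_pow_mul_eval {ι : Type*} [Fintype ι] {a : ι → ℂ}
    (ha : Function.Injective a) (h0 : ∀ i, a i ≠ 0) (P : ι → Polynomial ℂ) (K : ℕ)
    (h : ∀ k ≥ K, ∑ i, a i ^ k * (P i).eval (k : ℂ) = 0) (i : ι) : P i = 0 := by
  let f (i : ι) : ℕ → ℂ := fun k => a i ^ (k + K) * (P i).eval ((k + K : ℕ) : ℂ)
  have hf (i : ι) : f i ∈ shift.maxGenEigenspace (a i) := by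
    have : f i = ∑ n ∈ Finset.range ((P i).natDegree + 1), (P i).coeff n •
        fun k : ℕ => a i ^ (k + K) * ((k + K : ℕ) : ℂ) ^ n := by
      ext k
      simp only [f, Finset.sum_apply, Pi.smul_apply, smul_eq_mul]
      rw [Polynomial.eval_eq_sum_range, Finset.mul_sum]
      exact Finset.sum_congr rfl fun j _ => by ring
    rw [this]
    exact Submodule.sum_mem _ fun n _ =>
      Submodule.smul_mem _ _ (pow_mul_pow_mem_maxGenEigenspace (a i) K n)
  have hind := (Module.End.independent_maxGenEigenspace shift).comp ha
  rw [iSupIndep_iff_finsetSum_eq_zero_imp_eq_zero] at hind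
  have hz : f i = 0 := by
    refine hind Finset.univ f (fun i _ => hf i) ?_ i (Finset.mem_univ i)
    ext k
    simpa [f] using h (k + K) (Nat.le_add_left K k)
  refine Polynomial.eq_zero_of_infinite_isRoot _ (Set.Infinite.mono (s := Set.range
    fun k : ℕ => ((k + K : ℕ) : ℂ)) ?_ (Set.infinite_range_of_injective fun k l hkl => ?_))
  · rintro _ ⟨k, rfl⟩
    have := congrFun hz k
    exact (mul_eq_zero.1 this).resolve_left (pow_ne_zero _ (h0 i))
  · simpa using hkl

/-- If an exponential polynomial with coefficients in a vector space takes values in a subspace for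
all large arguments, then its coefficients lie in that subspace. -/
theorem mem_of_sum_pow_mem {ι M : Type*} [Fintype ι] [AddCommGroup M] [Module ℂ M] {a : ι → ℂ}
    (ha : Function.Injective a) (h0 : ∀ i, a i ≠ 0) (W : Submodule ℂ M) (w : ι → ℕ → M) (J K : ℕ)
    (h : ∀ k ≥ K, ∑ i, ∑ j ∈ Finset.range J, (a i ^ k * (-(k : ℂ)) ^ j) • w i j ∈ W)
    (i : ι) {j : ℕ} (hj : j < J) : w i j ∈ W := by
  -- Functionals on the quotient by `W` separate points, which reduces the claim to scalar
  -- coefficients.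
  rw [← Submodule.Quotient.mk_eq_zero, ← Module.forall_dual_apply_eq_zero_iff ℂ]
  intro φ
  let c (i : ι) (j : ℕ) : ℂ := φ (W.mkQ (w i j))
  let P (i : ι) : Polynomial ℂ := ∑ j ∈ Finset.range J, Polynomial.monomial j ((-1) ^ j * c i j)
  have hP : P i = 0 := by
    refine eq_zero_of_sum_pow_mul_eval ha h0 P K (fun k hk => ?_) i
    have h1 := congrArg φ ((Submodule.Quotient.mk_eq_zero W).2 (h k hk))
    rw [← Submodule.mkQ_apply] at h1
    simp only [map_sum, map_smul, map_zero, smul_eq_mul] at h1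
    rw [← h1]
    refine Finset.sum_congr rfl fun i _ => ?_
    rw [Polynomial.eval_finsetSum, Finset.mul_sum]
    refine Finset.sum_congr rfl fun j _ => ?_
    rw [Polynomial.eval_monomial, neg_pow (k : ℂ)]
    simp only [c]
    ring
  have h2 := congrArg (fun p => Polynomial.coeff p j) hP
  simp only [P, Polynomial.finsetSum_coeff, Polynomial.coeff_monomial, Polynomial.coeff_zero] at h2
  rw [Finset.sum_ite_eq' (Finset.range J) j, if_pos (Finset.mem_range.2 hj)] at h2
  exact (mul_eq_zero.1 h2).resolve_left (pow_ne_zero _ (by norm_num))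

end ExponentialPolynomials

/-! ### Schur's lemma in countable dimension and density -/

section Density

open Polynomial in
/-- An endomorphism of a nonzero complex vector space of countable dimension has nonempty
spectrum. -/
theorem exists_not_bijective_sub_algebraMap {V : Type v} [AddCommGroup V] [Module ℂ V]
    [Nontrivial V] (hV : Module.rank ℂ V ≤ Cardinal.aleph0) (φ : Module.End ℂ V) :
    ∃ c : ℂ, ¬ Function.Bijective (φ - algebraMap ℂ (Module.End ℂ V) c) := by
  by_contra! H
  -- If every `φ - c` is bijective, every nonzero polynomial in `φ` is injective, being a product of
  -- linear factors and a nonzero constant.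
  have hinj (p : ℂ[X]) (hp : p ≠ 0) : Function.Injective (aeval φ p) := by
    have hs := (IsAlgClosed.splits p).eq_prod_roots
    rw [hs, map_mul, aeval_C, Module.End.coe_mul]
    refine Function.Injective.comp ?_ ?_
    · intro x y hxy
      simpa [hp] using hxy
    · generalize p.roots = s
      induction s using Multiset.induction_on with
      | empty => exact fun x y hxy => by simpa using hxy
      | cons c s ih =>
        rw [Multiset.map_cons, Multiset.prod_cons, map_mul, Module.End.coe_mul]
        refine Function.Injective.comp ?_ ih
        simpa using (H c).1
  obtain ⟨v, hv⟩ := exists_ne (0 : V)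
  -- The vectors `w c = (φ - c)⁻¹ v` will form an uncountable independent family.
  choose w hw using fun c => (H c).2 v
  have hli : LinearIndependent ℂ w := by
    refine linearIndependent_iff'.2 fun s m hm i hi => ?_
    -- This is the numerator of `∑ m_i / (X - i)`. Its value at `i` is `m_i` times a nonzero
    -- product.
    let P : ℂ[X] := ∑ i ∈ s, C (m i) * ∏ j ∈ s.erase i, (X - C j)
    have hP : aeval φ P v = 0 := by
      have h1 := congrArg (aeval φ (∏ j ∈ s, (X - C j))) hm
      rw [map_zero, map_sum] at h1
      rw [← h1]
      simp only [P, map_sum, LinearMap.sum_apply]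
      refine Finset.sum_congr rfl fun i hi => ?_
      rw [map_mul, aeval_C, ← Finset.prod_erase_mul _ _ hi, map_mul, map_smul,
        Module.End.mul_apply, Module.End.mul_apply, map_sub, aeval_X, aeval_C, hw]
      simp
    have hP0 : P = 0 := by
      by_contra h
      exact hv (hinj P h (hP.trans (map_zero _).symm))
    have h2 := congrArg (eval i) hP0
    simp only [P, eval_finsetSum, eval_mul, eval_C, eval_prod, eval_sub, eval_X, eval_zero] at h2
    rw [Finset.sum_eq_single_of_mem i hi] at h2
    · refine (mul_eq_zero.1 h2).resolve_right (Finset.prod_ne_zero_iff.2 fun j hj => ?_)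
      exact sub_ne_zero.2 (Finset.ne_of_mem_erase hj).symm
    · intro j _ hji
      exact mul_eq_zero_of_right _ (Finset.prod_eq_zero (Finset.mem_erase.2 ⟨hji.symm, hi⟩)
        (sub_self i))
  have h3 := hli.cardinal_lift_le_rank
  rw [Cardinal.mk_complex, Cardinal.lift_continuum] at h3
  have h4 := h3.trans (Cardinal.lift_le.2 hV)
  rw [Cardinal.lift_aleph0] at h4
  exact absurd h4 (not_le.2 Cardinal.aleph0_lt_continuum)

variable {𝔤 : Type u} [LieRing 𝔤] [LieAlgebra ℂ 𝔤] [FiniteDimensional ℂ 𝔤]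
  {V : Type v} [AddCommGroup V] [Module ℂ V] [LieRingModule 𝔤 V] [LieModule ℂ 𝔤 V]

variable (𝔤 V) in
/-- Irreducible modules over a finite-dimensional Lie algebra have countable dimension. -/
theorem rank_le_aleph0_of_isIrreducible [LieModule.IsIrreducible ℂ 𝔤 V] :
    Module.rank ℂ V ≤ Cardinal.aleph0 := by
  have : Nontrivial V := LieModule.nontrivial_of_isIrreducible ℂ 𝔤 V
  obtain ⟨v, hv⟩ := exists_ne (0 : V)
  let e := Module.finBasis ℂ 𝔤
  -- Words in a basis of `𝔤` applied to `v`: there are countably many, and their span is stable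
  -- under `𝔤`.
  let g (s : List (Fin (Module.finrank ℂ 𝔤))) : V := s.foldr (fun i x => ⁅e i, x⁆) v
  let N : LieSubmodule ℂ 𝔤 V :=
    { Submodule.span ℂ (Set.range g) with
      lie_mem := by
        intro x y hy
        change ⁅x, y⁆ ∈ Submodule.span ℂ (Set.range g)
        change y ∈ Submodule.span ℂ (Set.range g) at hy
        induction hy using Submodule.span_induction with
        | mem y hy =>
          obtain ⟨s, rfl⟩ := hy
          rw [← e.sum_repr x, sum_lie]
          refine Submodule.sum_mem _ fun i _ => ?_
          rw [smul_lie]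
          exact Submodule.smul_mem _ _ (Submodule.subset_span ⟨i :: s, rfl⟩)
        | zero => rw [lie_zero]; exact Submodule.zero_mem _
        | add y z _ _ hy hz => rw [lie_add]; exact Submodule.add_mem _ hy hz
        | smul c y _ hy => rw [lie_smul]; exact Submodule.smul_mem _ _ hy }
  have hvN : v ∈ N := Submodule.subset_span ⟨[], rfl⟩
  have hN : N = ⊤ := (eq_bot_or_eq_top N).resolve_left fun h => hv <| by
    rw [h] at hvN
    simpa using hvN
  have hspan : Submodule.span ℂ (Set.range g) = ⊤ := congrArg LieSubmodule.toSubmodule hN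
  rw [← rank_top ℂ V, ← hspan]
  exact (rank_span_le _).trans (Cardinal.mk_le_aleph0_iff.2 (Set.countable_range g).to_subtype)

/-- The density theorem for an irreducible module over a finite-dimensional complex Lie algebra. -/
theorem exists_mem_forall_apply_eq [LieModule.IsIrreducible ℂ 𝔤 V]
    (A : Subalgebra ℂ (Module.End ℂ V)) (hA : ∀ x : 𝔤, LieModule.toEnd ℂ 𝔤 V x ∈ A)
    (f : Module.End ℂ V) (s : Finset V) : ∃ α ∈ A, ∀ v ∈ s, f v = α v := by
  have : Nontrivial V := LieModule.nontrivial_of_isIrreducible ℂ 𝔤 V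
  have hlie (x : 𝔤) (v : V) : ⁅x, v⁆ = (⟨_, hA x⟩ : A) • v := rfl
  have hsimple : IsSimpleModule A V := by
    rw [isSimpleModule_iff]
    refine { eq_bot_or_eq_top := fun N => ?_ }
    let N' : LieSubmodule ℂ 𝔤 V :=
      { N.restrictScalars ℂ with
        lie_mem := fun {x v} hv => by
          rw [hlie]
          exact N.smul_mem _ hv }
    rcases eq_bot_or_eq_top N' with h | h
    · left
      rw [Submodule.eq_bot_iff]
      intro v hv
      have : v ∈ N' := hv
      rw [h] at this
      simpa using this
    · right
      rw [Submodule.eq_top_iff']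
      intro v
      have : v ∈ N' := by rw [h]; trivial
      exact this
  have hscalar (φ : Module.End A V) : ∃ c : ℂ, ∀ v, φ v = c • v := by
    obtain ⟨c, hc⟩ := exists_not_bijective_sub_algebraMap
      (rank_le_aleph0_of_isIrreducible 𝔤 V) (φ.restrictScalars ℂ)
    refine ⟨c, fun v => ?_⟩
    let ψ : Module.End A V := φ - algebraMap ℂ (Module.End A V) c
    rcases ψ.bijective_or_eq_zero with h | h
    · exact absurd h hc
    · simpa [ψ, sub_eq_zero] using LinearMap.congr_fun h v
  -- The commutant of `A` consists of scalars, so any `ℂ`-linear `f` commutes with it and Jacobson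
  -- density applies.
  let F : Module.End (Module.End A V) V :=
    { f with
      map_smul' := fun φ v => by
        obtain ⟨c, hc⟩ := hscalar φ
        simp [hc] }
  obtain ⟨r, hr⟩ := jacobson_density F s
  exact ⟨r.1, r.2, hr⟩

end Density

/-! ### Invariant subspaces of `(V_1 ⊗ ⋯ ⊗ V_m) ⊗ X` -/

section InvariantSubspaces

/-- For a subspace `Z` of `E ⊗ X`, the largest subspace `Y` of `X` such that `E ⊗ Y ⊆ Z`. -/
def rightPart {E : Type v} {X : Type w} [AddCommGroup E] [Module ℂ E] [AddCommGroup X]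
    [Module ℂ X] (Z : Submodule ℂ (E ⊗[ℂ] X)) : Submodule ℂ X :=
  ⨅ e : E, Z.comap (TensorProduct.mk ℂ E X e)

theorem mem_rightPart {E : Type v} {X : Type w} [AddCommGroup E] [Module ℂ E] [AddCommGroup X]
    [Module ℂ X] {Z : Submodule ℂ (E ⊗[ℂ] X)} {y : X} :
    y ∈ rightPart Z ↔ ∀ e : E, e ⊗ₜ y ∈ Z := by
  simp [rightPart]

/-- The tensor product of the `α i` is a composite of maps acting on one factor each, built up one
index at a time. -/
theorem rTensor_map_mem {m : ℕ} {V : Fin m → Type v} [∀ i, AddCommGroup (V i)]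
    [∀ i, Module ℂ (V i)] {X : Type w} [AddCommGroup X] [Module ℂ X]
    {Z : Submodule ℂ ((⨂[ℂ] i, V i) ⊗[ℂ] X)} {α : ∀ i, Module.End ℂ (V i)}
    (h : ∀ i, ∀ z ∈ Z, (actAt V i (α i)).rTensor X z ∈ Z) {z : (⨂[ℂ] i, V i) ⊗[ℂ] X}
    (hz : z ∈ Z) : (PiTensorProduct.map α).rTensor X z ∈ Z := by
  classical
  suffices H : ∀ s : Finset (Fin m), (PiTensorProduct.map (fun i => if i ∈ s then α i else
      LinearMap.id)).rTensor X z ∈ Z by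
    simpa using H Finset.univ
  intro s
  induction s using Finset.induction_on with
  | empty => simpa using hz
  | insert i s hi ih =>
    have := h i _ ih
    rw [← LinearMap.comp_apply, ← LinearMap.rTensor_comp, actAt,
      ← PiTensorProduct.map_comp] at this
    convert this using 3
    congr 1
    funext j
    by_cases hj : j = i
    · subst hj; simp [hi]
    · simp [hj]

variable {𝔤 : Type u} [LieRing 𝔤] [LieAlgebra ℂ 𝔤] [FiniteDimensional ℂ 𝔤] {m : ℕ}
  {V : Fin m → Type v} [∀ i, AddCommGroup (V i)] [∀ i, Module ℂ (V i)]
  [∀ i, LieRingModule 𝔤 (V i)] [∀ i, LieModule ℂ 𝔤 (V i)]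
  {X : Type w} [AddCommGroup X] [Module ℂ X]

/-- If the `V_i` are irreducible, a subspace of `(V_1 ⊗ ⋯ ⊗ V_m) ⊗ X` that is invariant under `𝔤`
acting on each of the factors `V_i` separately is of the form `(V_1 ⊗ ⋯ ⊗ V_m) ⊗ Y`. -/
theorem equivFinsuppOfBasisLeft_mem_rightPart (hV : ∀ i, LieModule.IsIrreducible ℂ 𝔤 (V i))
    {Z : Submodule ℂ ((⨂[ℂ] i, V i) ⊗[ℂ] X)}
    (hZ : ∀ (i : Fin m) (x : 𝔤), ∀ z ∈ Z,
      (actAt V i (LieModule.toEnd ℂ 𝔤 (V i) x)).rTensor X z ∈ Z)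
    {κ : Fin m → Type*} [DecidableEq (∀ i, κ i)] (b : ∀ i, Module.Basis (κ i) ℂ (V i))
    {z : (⨂[ℂ] i, V i) ⊗[ℂ] X} (hz : z ∈ Z) (p : ∀ i, κ i) :
    TensorProduct.equivFinsuppOfBasisLeft (Basis.piTensorProduct b) z p
      ∈ rightPart Z := by
  classical
  set B := Basis.piTensorProduct b with hB
  set c := TensorProduct.equivFinsuppOfBasisLeft (N := X) B z with hc
  rw [mem_rightPart]
  have hzc : z = c.sum fun q y => B q ⊗ₜ y := by
    rw [← TensorProduct.equivFinsuppOfBasisLeft_symm_apply, hc, LinearEquiv.symm_apply_apply]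
  suffices H : ∀ u : ∀ i, V i, PiTensorProduct.tprod ℂ u ⊗ₜ[ℂ] c p ∈ Z by
    intro e
    have he : e ∈ Submodule.span ℂ (Set.range (PiTensorProduct.tprod ℂ (s := V))) := by
      rw [PiTensorProduct.span_tprod_eq_top]; trivial
    induction he using Submodule.span_induction with
    | mem e he => obtain ⟨u, rfl⟩ := he; exact H u
    | zero => rw [TensorProduct.zero_tmul]; exact Z.zero_mem
    | add e f _ _ he hf => rw [TensorProduct.add_tmul]; exact Z.add_mem he hf
    | smul r e _ he => rw [← TensorProduct.smul_tmul']; exact Z.smul_mem _ he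
  intro u
  -- The endomorphisms of `V i` that preserve `Z` form a subalgebra containing the image of `𝔤`, so
  -- density applies to it.
  let A (i : Fin m) : Subalgebra ℂ (Module.End ℂ (V i)) :=
    { carrier := {φ | ∀ z ∈ Z, (actAt V i φ).rTensor X z ∈ Z}
      mul_mem' := fun {φ ψ} hφ hψ z hz => by
        rw [← actAt_mul, Module.End.mul_eq_comp, LinearMap.rTensor_comp]
        exact hφ _ (hψ _ hz)
      add_mem' := fun {φ ψ} hφ hψ z hz => by
        rw [actAt_add, LinearMap.rTensor_add]
        exact Z.add_mem (hφ _ hz) (hψ _ hz)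
      algebraMap_mem' := fun r z hz => by
        have h1 : actAt V i (LinearMap.id) = LinearMap.id := by
          simp [actAt]
        rw [Algebra.algebraMap_eq_smul_one, actAt_smul, Module.End.one_eq_id, h1,
          LinearMap.rTensor_smul, LinearMap.rTensor_id]
        exact Z.smul_mem _ hz }
  -- On the finitely many basis vectors occurring in `z`, `α i` sends `b i (p i)` to `u i` and the
  -- others to zero. Hence `⊗ α i` isolates the coordinate of `z` at `p`. The vector `b i (p i)` is
  -- inserted because `p` may lie outside the support.
  have hα (i : Fin m) := exists_mem_forall_apply_eq (𝔤 := 𝔤) (A i) (hZ i)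
    ((b i).constr ℂ fun k => if k = p i then u i else 0)
    (insert (b i (p i)) (c.support.image fun q => b i (q i)))
  choose α hαA hα using hα
  have key := rTensor_map_mem hαA hz
  have hp : (PiTensorProduct.map α) (B p) = PiTensorProduct.tprod ℂ u := by
    rw [hB, Basis.piTensorProduct_apply, PiTensorProduct.map_tprod]
    congr 1
    ext i
    rw [← hα i _ (Finset.mem_insert_self _ _)]
    simp
  have hq (q) (hq : q ∈ c.support) (hqp : q ≠ p) : (PiTensorProduct.map α) (B q) = 0 := by
    obtain ⟨i, hi⟩ := Function.ne_iff.1 hqp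
    rw [hB, Basis.piTensorProduct_apply, PiTensorProduct.map_tprod]
    refine MultilinearMap.map_coord_zero _ i ?_
    rw [← hα i _ (Finset.mem_insert_of_mem (Finset.mem_image_of_mem _ hq))]
    simp [hi]
  rw [hzc, Finsupp.sum, map_sum, Finset.sum_eq_single p] at key
  · rwa [LinearMap.rTensor_tmul, hp] at key
  · intro q hqs hqp
    rw [LinearMap.rTensor_tmul, hq q hqs hqp, TensorProduct.zero_tmul]
  · intro h
    rw [Finsupp.notMem_support_iff.1 h, TensorProduct.tmul_zero, map_zero]

theorem mem_span_tmul_rightPart (hV : ∀ i, LieModule.IsIrreducible ℂ 𝔤 (V i))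
    {Z : Submodule ℂ ((⨂[ℂ] i, V i) ⊗[ℂ] X)}
    (hZ : ∀ (i : Fin m) (x : 𝔤), ∀ z ∈ Z,
      (actAt V i (LieModule.toEnd ℂ 𝔤 (V i) x)).rTensor X z ∈ Z)
    {z : (⨂[ℂ] i, V i) ⊗[ℂ] X} (hz : z ∈ Z) :
    z ∈ Submodule.span ℂ {t | ∃ e, ∃ y ∈ rightPart Z, t = e ⊗ₜ[ℂ] y} := by
  classical
  let b (i : Fin m) := Module.Basis.ofVectorSpace ℂ (V i)
  have h := TensorProduct.equivFinsuppOfBasisLeft_symm_apply (Basis.piTensorProduct b)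
    (TensorProduct.equivFinsuppOfBasisLeft (N := X) (Basis.piTensorProduct b) z)
  rw [LinearEquiv.symm_apply_apply] at h
  rw [h]
  exact Submodule.sum_mem _ fun p _ => Submodule.subset_span
    ⟨_, _, equivFinsuppOfBasisLeft_mem_rightPart hV hZ b hz p, rfl⟩

/-- Some coordinate of `e ⊗ y` is a nonzero multiple of `y`. Thus a single nonzero `e` suffices to
test membership in `rightPart Z`. -/
theorem mem_rightPart_of_tmul_mem (hV : ∀ i, LieModule.IsIrreducible ℂ 𝔤 (V i))
    {Z : Submodule ℂ ((⨂[ℂ] i, V i) ⊗[ℂ] X)}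
    (hZ : ∀ (i : Fin m) (x : 𝔤), ∀ z ∈ Z,
      (actAt V i (LieModule.toEnd ℂ 𝔤 (V i) x)).rTensor X z ∈ Z)
    {e : ⨂[ℂ] i, V i} (he : e ≠ 0) {y : X} (hy : e ⊗ₜ y ∈ Z) : y ∈ rightPart Z := by
  classical
  let B := Basis.piTensorProduct fun i => Module.Basis.ofVectorSpace ℂ (V i)
  obtain ⟨p, hp⟩ : ∃ p, B.repr e p ≠ 0 := by
    by_contra! h
    exact he (B.repr.map_eq_zero_iff.1 (Finsupp.ext h))
  have h := equivFinsuppOfBasisLeft_mem_rightPart hV hZ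
    (fun i => Module.Basis.ofVectorSpace ℂ (V i)) hy p
  rw [TensorProduct.equivFinsuppOfBasisLeft_apply_tmul_apply] at h
  exact (Submodule.smul_mem_iff _ hp).1 h

theorem tprod_ne_zero {ι : Type*} [Finite ι] {V : ι → Type*} [∀ i, AddCommGroup (V i)]
    [∀ i, Module ℂ (V i)] {x : ∀ i, V i} (hx : ∀ i, x i ≠ 0) : PiTensorProduct.tprod ℂ x ≠ 0 := by
  have := Fintype.ofFinite ι
  intro h
  let b (i : ι) := Module.Basis.ofVectorSpace ℂ (V i)
  have hp (i : ι) : ∃ k, (b i).repr (x i) k ≠ 0 := by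
    by_contra! h
    exact hx i ((b i).repr.map_eq_zero_iff.1 (Finsupp.ext h))
  choose p hp using hp
  have h1 := Basis.piTensorProduct_repr_tprod_apply b x p
  rw [h, map_zero, Finsupp.zero_apply] at h1
  exact Finset.prod_ne_zero_iff.2 (fun i _ => hp i) h1.symm

end InvariantSubspaces

open Polynomial

/-! ### Subspaces of `ℂ[X] ⊗ L` stable under multiplication by `X` and differentiation -/

section Polynomials

variable {L : Type w} [AddCommGroup L] [Module ℂ L]

theorem exists_eq_sum_X_pow_tmul (y : ℂ[X] ⊗[ℂ] L) :
    ∃ (v : ℕ → L) (n : ℕ), y = ∑ k ∈ Finset.range n, (X ^ k : ℂ[X]) ⊗ₜ[ℂ] v k := by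
  obtain ⟨c, rfl⟩ := TensorProduct.eq_repr_basis_left (Polynomial.basisMonomials ℂ) y
  refine ⟨c, c.support.sup id + 1, ?_⟩
  rw [Finsupp.sum]
  simp only [coe_basisMonomials, monomial_one_right_eq_X_pow]
  refine Finset.sum_subset (fun k hk => ?_) fun k _ hk => ?_
  · exact Finset.mem_range.2 (Nat.lt_succ_of_le (Finset.le_sup (f := id) hk))
  · rw [Finsupp.notMem_support_iff.1 hk, TensorProduct.tmul_zero]

theorem X_pow_tmul_mem {Y : Submodule ℂ (ℂ[X] ⊗[ℂ] L)}
    (hX : ∀ y ∈ Y, (LinearMap.mulLeft ℂ (X : ℂ[X])).rTensor L y ∈ Y) {v : L}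
    (hv : (1 : ℂ[X]) ⊗ₜ v ∈ Y) (n : ℕ) : (X ^ n : ℂ[X]) ⊗ₜ v ∈ Y := by
  induction n with
  | zero => simpa using hv
  | succ n ih => simpa [pow_succ'] using hX _ ih

/-- Differentiating as often as the top exponent leaves only the top coefficient, times a factorial.
Multiplying back by a power of `X` and subtracting gives the induction. -/
theorem one_tmul_mem_of_sum_mem {Y : Submodule ℂ (ℂ[X] ⊗[ℂ] L)}
    (hX : ∀ y ∈ Y, (LinearMap.mulLeft ℂ (X : ℂ[X])).rTensor L y ∈ Y)
    (hd : ∀ y ∈ Y, (derivative : ℂ[X] →ₗ[ℂ] ℂ[X]).rTensor L y ∈ Y) {v : ℕ → L} {n : ℕ}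
    (h : ∑ k ∈ Finset.range n, (X ^ k : ℂ[X]) ⊗ₜ[ℂ] v k ∈ Y) {k : ℕ} (hk : k < n) :
    (1 : ℂ[X]) ⊗ₜ v k ∈ Y := by
  induction n generalizing k with
  | zero => omega
  | succ n ih =>
    have hiter (j : ℕ) : ∀ y ∈ Y, ((derivative : ℂ[X] →ₗ[ℂ] ℂ[X]) ^ j).rTensor L y ∈ Y := by
      induction j with
      | zero => intro y hy; simpa [Module.End.one_eq_id] using hy
      | succ j ihj =>
        intro y hy
        rw [pow_succ, Module.End.mul_eq_comp, LinearMap.rTensor_comp]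
        exact ihj _ (hd y hy)
    have hn : (1 : ℂ[X]) ⊗ₜ v n ∈ Y := by
      have h1 := hiter n _ h
      rw [map_sum, Finset.sum_range_succ, Finset.sum_eq_zero, zero_add] at h1
      · rw [LinearMap.rTensor_tmul, Module.End.pow_apply, iterate_derivative_X_pow_eq_smul,
          Nat.descFactorial_self, Nat.sub_self, pow_zero, ← TensorProduct.smul_tmul',
          Submodule.smul_mem_iff _ (Nat.cast_ne_zero.2 n.factorial_ne_zero)] at h1
        exact h1
      · intro k hk
        rw [LinearMap.rTensor_tmul, Module.End.pow_apply, iterate_derivative_eq_zero,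
          TensorProduct.zero_tmul]
        simpa using hk
    rcases (Nat.lt_succ_iff_lt_or_eq.1 hk) with hk | rfl
    · refine ih ?_ hk
      rw [Finset.sum_range_succ] at h
      exact (Submodule.add_mem_iff_left _ (X_pow_tmul_mem hX hn n)).1 h
    · exact hn

end Polynomials

/-! ### Modules induced from `ĝ` to `g̃` -/

section InducedModules

theorem taylor_eq_sum_hasseDeriv {f : ℂ[X]} {J : ℕ} (hJ : f.natDegree < J) (r : ℂ) :
    taylor r f = ∑ j ∈ Finset.range J, r ^ j • hasseDeriv j f := by
  ext n
  rw [taylor_coeff, eval_eq_sum_range' (n := J), finsetSum_coeff]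
  · refine Finset.sum_congr rfl fun j _ => ?_
    rw [coeff_smul, hasseDeriv_coeff, hasseDeriv_coeff, add_comm j n,
      Nat.choose_symm_add, smul_eq_mul, mul_comm]
  · exact (natDegree_hasseDeriv_le f n).trans_lt (by omega)

theorem mul_aeval_eq_aeval_taylor_mul {A : Type*} [Ring A] [Algebra ℂ A] {y d : A} {r : ℂ}
    (h : y * d = (d + algebraMap ℂ A r) * y) (f : ℂ[X]) :
    y * aeval d f = aeval d (taylor r f) * y := by
  rw [taylor_apply, aeval_comp, map_add, aeval_X, aeval_C]
  induction f using Polynomial.induction_on with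
  | C c => rw [aeval_C, aeval_C, Algebra.commutes]
  | add p q hp hq => rw [map_add, map_add, mul_add, add_mul, hp, hq]
  | monomial n c ih =>
    rw [pow_succ, ← mul_assoc, map_mul, map_mul (aeval (d + _)), aeval_X, aeval_X, ← mul_assoc, ih,
      mul_assoc, h, mul_assoc]

/-- By the universal property, the identity of the enveloping algebra factors through the subalgebra
generated by the image of `𝔩`. -/
theorem adjoin_range_ι (𝔩 : Type v) [LieRing 𝔩] [LieAlgebra ℂ 𝔩] :
    Algebra.adjoin ℂ (Set.range (UniversalEnvelopingAlgebra.ι ℂ : 𝔩 → _)) = ⊤ := by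
  let S : Subalgebra ℂ (UniversalEnvelopingAlgebra ℂ 𝔩) :=
    Algebra.adjoin ℂ (Set.range (UniversalEnvelopingAlgebra.ι ℂ))
  let g : 𝔩 →ₗ⁅ℂ⁆ S :=
    { toFun := fun x => ⟨UniversalEnvelopingAlgebra.ι ℂ x, Algebra.subset_adjoin ⟨x, rfl⟩⟩
      map_add' := fun x y => Subtype.ext (map_add _ x y)
      map_smul' := fun c x => Subtype.ext (map_smul _ c x)
      map_lie' := fun {x y} => Subtype.ext (LieHom.map_lie _ x y) }
  have h : (Subalgebra.val S).comp (UniversalEnvelopingAlgebra.lift ℂ g) =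
      AlgHom.id ℂ (UniversalEnvelopingAlgebra ℂ 𝔩) := by
    refine UniversalEnvelopingAlgebra.hom_ext ℂ ?_
    ext x
    change ((UniversalEnvelopingAlgebra.lift ℂ g (UniversalEnvelopingAlgebra.ι ℂ x) : S) : _) =
      UniversalEnvelopingAlgebra.ι ℂ x
    rw [UniversalEnvelopingAlgebra.lift_ι_apply]
    rfl
  refine eq_top_iff.2 fun u _ => ?_
  have := DFunLike.congr_fun h u
  rw [AlgHom.id_apply] at this
  rw [← this]
  exact (UniversalEnvelopingAlgebra.lift ℂ g u).2

variable (𝔤 : Type u) [LieRing 𝔤] [LieAlgebra ℂ 𝔤]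

/-- The element `d` of `U(g̃)`. -/
def degreeElement : UniversalEnvelopingAlgebra ℂ (Tilde 𝔤) :=
  UniversalEnvelopingAlgebra.ι ℂ (LieAlgebra.SemiDirectSum.inr (degreeHom 𝔤) 1)

variable {𝔤}

theorem ι_hatToTilde_mul_degreeElement (y : Hat 𝔤) :
    UniversalEnvelopingAlgebra.ι ℂ (hatToTilde 𝔤 y) * degreeElement 𝔤 =
      degreeElement 𝔤 * UniversalEnvelopingAlgebra.ι ℂ (hatToTilde 𝔤 y) -
        UniversalEnvelopingAlgebra.ι ℂ (hatToTilde 𝔤 (degree 𝔤 y)) := by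
  have h : hatToTilde 𝔤 (degree 𝔤 y) =
      ⁅LieAlgebra.SemiDirectSum.inr (degreeHom 𝔤) 1, hatToTilde 𝔤 y⁆ := by
    ext
    · change degree 𝔤 y = ⁅(0 : Hat 𝔤), y⁆ + ((1 : ℂ) • degree 𝔤) y - ((0 : ℂ) • degree 𝔤) 0
      simp
    · simp
  rw [h, LieHom.map_lie, LieRing.of_associative_ring_bracket, degreeElement, sub_sub_cancel]

theorem degree_single (k : ℤ) (x : 𝔤) :
    degree 𝔤 (Hat.single k x) = (k : ℂ) • Hat.single k x := by
  change Hat.mk (loopDegree 𝔤 (AddMonoidAlgebra.single k 1 ⊗ₜ[ℂ] x)) 0 =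
    Hat.mk ((k : ℂ) • (AddMonoidAlgebra.single k 1 ⊗ₜ[ℂ] x)) ((k : ℂ) • 0)
  rw [loopDegree_single_tmul, smul_zero]

/-- The relation `[d, x ⊗ t^k] = k x ⊗ t^k` gives `(x ⊗ t^k) d = (d - k) (x ⊗ t^k)`. -/
theorem ι_single_mul_aeval (k : ℤ) (x : 𝔤) (f : ℂ[X]) :
    UniversalEnvelopingAlgebra.ι ℂ (hatToTilde 𝔤 (Hat.single k x)) * aeval (degreeElement 𝔤) f =
      aeval (degreeElement 𝔤) (taylor (-(k : ℂ)) f) *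
        UniversalEnvelopingAlgebra.ι ℂ (hatToTilde 𝔤 (Hat.single k x)) := by
  refine mul_aeval_eq_aeval_taylor_mul ?_ f
  rw [ι_hatToTilde_mul_degreeElement, degree_single, map_smul, map_smul, add_mul, map_neg,
    neg_mul, ← sub_eq_add_neg, Algebra.smul_def]

variable (𝔤) (M : Type w) [AddCommGroup M] [Module ℂ M] [LieRingModule (Hat 𝔤) M]

/-- The map `ℂ[X] ⊗ M → Ind M`, `f ⊗ m ↦ f(d) ⊗ m`. -/
def polyInd : ℂ[X] ⊗[ℂ] M →ₗ[ℂ] Ind (hatToTilde 𝔤) M :=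
  ((indRel (hatToTilde 𝔤) M).mkQ.restrictScalars ℂ) ∘ₗ
    TensorProduct.map (aeval (degreeElement 𝔤)).toLinearMap LinearMap.id

variable {𝔤} {M}

/-- The class of `u ⊗ m` in the induced module. -/
def Ind.mk (u : UniversalEnvelopingAlgebra ℂ (Tilde 𝔤)) (m : M) : Ind (hatToTilde 𝔤) M :=
  (indRel (hatToTilde 𝔤) M).mkQ (u ⊗ₜ m)

theorem Ind.smul_mk (u u' : UniversalEnvelopingAlgebra ℂ (Tilde 𝔤)) (m : M) :
    u • Ind.mk u' m = Ind.mk (u * u') m :=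
  ((indRel (hatToTilde 𝔤) M).mkQ.map_smul u (u' ⊗ₜ m)).symm

theorem Ind.mk_mul_ι (u : UniversalEnvelopingAlgebra ℂ (Tilde 𝔤)) (y : Hat 𝔤) (m : M) :
    Ind.mk (u * UniversalEnvelopingAlgebra.ι ℂ (hatToTilde 𝔤 y)) m = Ind.mk u ⁅y, m⁆ :=
  (Submodule.Quotient.eq _).2 (Submodule.subset_span ⟨u, y, m, rfl⟩)

theorem lie_def (x : Tilde 𝔤) (z : Ind (hatToTilde 𝔤) M) :
    ⁅x, z⁆ = UniversalEnvelopingAlgebra.ι ℂ x • z := rfl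

theorem polyInd_tmul (f : ℂ[X]) (m : M) :
    polyInd 𝔤 M (f ⊗ₜ m) = Ind.mk (aeval (degreeElement 𝔤) f) m := rfl

theorem degreeElement_smul_polyInd (t : ℂ[X] ⊗[ℂ] M) :
    degreeElement 𝔤 • polyInd 𝔤 M t =
      polyInd 𝔤 M ((LinearMap.mulLeft ℂ (X : ℂ[X])).rTensor M t) := by
  induction t using TensorProduct.induction_on with
  | zero => simp
  | add s t hs ht => rw [map_add, smul_add, hs, ht, map_add, map_add]
  | tmul f m =>
    rw [LinearMap.rTensor_tmul, polyInd_tmul, polyInd_tmul, Ind.smul_mk, LinearMap.mulLeft_apply,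
      map_mul, aeval_X]

theorem lie_single_polyInd (k : ℤ) (x : 𝔤) (f : ℂ[X]) (m : M) :
    ⁅hatToTilde 𝔤 (Hat.single k x), polyInd 𝔤 M (f ⊗ₜ m)⁆ =
      polyInd 𝔤 M (taylor (-(k : ℂ)) f ⊗ₜ ⁅Hat.single k x, m⁆) := by
  rw [lie_def, polyInd_tmul, polyInd_tmul, Ind.smul_mk, ι_single_mul_aeval, Ind.mk_mul_ι]

theorem lie_polyInd_one_tmul (y : Hat 𝔤) (m : M) :
    ⁅hatToTilde 𝔤 y, polyInd 𝔤 M (1 ⊗ₜ m)⁆ = polyInd 𝔤 M (1 ⊗ₜ ⁅y, m⁆) := by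
  rw [lie_def, polyInd_tmul, polyInd_tmul, Ind.smul_mk, map_one, mul_one,
    ← Ind.mk_mul_ι, one_mul]

theorem ι_hatToTilde_smul_mem_range (n : ℕ) (y : Hat 𝔤) (m : M) :
    UniversalEnvelopingAlgebra.ι ℂ (hatToTilde 𝔤 y) • polyInd 𝔤 M ((X ^ n : ℂ[X]) ⊗ₜ m) ∈
      LinearMap.range (polyInd 𝔤 M) := by
  -- Commuting `y` past `d` produces the new element `degree 𝔤 y`, so `y` must vary.
  induction n generalizing y with
  | zero =>
    rw [pow_zero, ← lie_def, lie_polyInd_one_tmul]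
    exact ⟨_, rfl⟩
  | succ n ih =>
    have h : polyInd 𝔤 M ((X ^ (n + 1) : ℂ[X]) ⊗ₜ m) =
        degreeElement 𝔤 • polyInd 𝔤 M ((X ^ n : ℂ[X]) ⊗ₜ m) := by
      rw [degreeElement_smul_polyInd, LinearMap.rTensor_tmul, LinearMap.mulLeft_apply, pow_succ']
    rw [h, ← mul_smul, ι_hatToTilde_mul_degreeElement, sub_smul, mul_smul]
    refine Submodule.sub_mem _ ?_ (ih _)
    obtain ⟨t, ht⟩ := ih y
    rw [← ht, degreeElement_smul_polyInd]
    exact ⟨_, rfl⟩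

-- The range contains `1 ⊗ M` and is stable under `ĝ` and `d`, hence under all of `U(g̃)`. This is
-- the spanning half of the Poincaré-Birkhoff-Witt theorem; injectivity is never needed.
variable (M) in
theorem polyInd_surjective : Function.Surjective (polyInd 𝔤 M) := by
  have hι (x : Tilde 𝔤) (z) (hz : z ∈ LinearMap.range (polyInd 𝔤 M)) :
      UniversalEnvelopingAlgebra.ι ℂ x • z ∈ LinearMap.range (polyInd 𝔤 M) := by
    obtain ⟨t, rfl⟩ := hz
    have hx : x = hatToTilde 𝔤 x.left +
        x.right • LieAlgebra.SemiDirectSum.inr (degreeHom 𝔤) 1 := by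
      ext <;> simp
    rw [hx, map_add, map_smul, add_smul, smul_assoc]
    refine Submodule.add_mem _ ?_ (Submodule.smul_mem _ _ ?_)
    · obtain ⟨v, n, rfl⟩ := exists_eq_sum_X_pow_tmul t
      rw [map_sum, Finset.smul_sum]
      exact Submodule.sum_mem _ fun k _ => ι_hatToTilde_smul_mem_range k _ _
    · exact ⟨_, (degreeElement_smul_polyInd t).symm⟩
  have hu (u : UniversalEnvelopingAlgebra ℂ (Tilde 𝔤)) :
      ∀ z ∈ LinearMap.range (polyInd 𝔤 M),
        u • z ∈ LinearMap.range (polyInd 𝔤 M) := by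
    have hu : u ∈ Algebra.adjoin ℂ (Set.range (UniversalEnvelopingAlgebra.ι ℂ : Tilde 𝔤 → _)) := by
      rw [adjoin_range_ι]; trivial
    induction hu using Algebra.adjoin_induction with
    | mem u hu => obtain ⟨x, rfl⟩ := hu; exact hι x
    | algebraMap c =>
      intro z hz
      rw [algebraMap_smul]
      exact Submodule.smul_mem _ _ hz
    | add u v _ _ hu hv => exact fun z hz =>
        (add_smul u v z).symm ▸ Submodule.add_mem _ (hu z hz) (hv z hz)
    | mul u v _ _ hu hv => exact fun z hz => (mul_smul u v z).symm ▸ hu _ (hv z hz)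
  intro z
  obtain ⟨t, rfl⟩ := (indRel (hatToTilde 𝔤) M).mkQ_surjective z
  change (indRel (hatToTilde 𝔤) M).mkQ t ∈ LinearMap.range (polyInd 𝔤 M)
  induction t using TensorProduct.induction_on with
  | zero => rw [map_zero]; exact Submodule.zero_mem _
  | add s t hs ht => rw [map_add]; exact Submodule.add_mem _ hs ht
  | tmul u m =>
    have := hu u _ ⟨1 ⊗ₜ m, rfl⟩
    rwa [polyInd_tmul, map_one, Ind.smul_mk, mul_one] at this

theorem map_polyInd {M' : Type w'} [AddCommGroup M'] [Module ℂ M'] [LieRingModule (Hat 𝔤) M']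
    [LieModule ℂ (Hat 𝔤) M'] (φ : M →ₗ⁅ℂ,Hat 𝔤⁆ M') (f : ℂ[X]) (m : M) :
    Ind.map (hatToTilde 𝔤) φ (polyInd 𝔤 M (f ⊗ₜ m)) = polyInd 𝔤 M' (f ⊗ₜ φ m) := rfl

theorem mem_submodule_of_mem [LieModule ℂ (Hat 𝔤) M] {P : LieSubmodule ℂ (Hat 𝔤) M} {m : M}
    (hm : m ∈ P) (f : ℂ[X]) :
    polyInd 𝔤 M (f ⊗ₜ m) ∈ Ind.submodule (hatToTilde 𝔤) P :=
  ⟨polyInd 𝔤 P (f ⊗ₜ ⟨m, hm⟩), map_polyInd P.incl f ⟨m, hm⟩⟩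

theorem submodule_le [LieModule ℂ (Hat 𝔤) M] {P : LieSubmodule ℂ (Hat 𝔤) M}
    {W : LieSubmodule ℂ (Tilde 𝔤) (Ind (hatToTilde 𝔤) M)}
    (h : ∀ m ∈ P, ∀ f : ℂ[X], polyInd 𝔤 M (f ⊗ₜ m) ∈ W) :
    Ind.submodule (hatToTilde 𝔤) P ≤ W := by
  rintro _ ⟨z, rfl⟩
  obtain ⟨t, rfl⟩ := polyInd_surjective P z
  change Ind.map (hatToTilde 𝔤) P.incl (polyInd 𝔤 P t) ∈ W
  induction t using TensorProduct.induction_on with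
  | zero => simp
  | add s t hs ht => rw [map_add, map_add]; exact W.add_mem hs ht
  | tmul f m => rw [map_polyInd]; exact h _ m.2 f

end InducedModules

theorem tensorSubmodule_le {𝔨 : Type u} [LieRing 𝔨] [LieAlgebra ℂ 𝔨]
    {E : Type v} [AddCommGroup E] [Module ℂ E] [LieRingModule 𝔨 E] [LieModule ℂ 𝔨 E]
    {L : Type w} [AddCommGroup L] [Module ℂ L] [LieRingModule 𝔨 L] [LieModule ℂ 𝔨 L]
    {N : LieSubmodule ℂ 𝔨 L} {S : Submodule ℂ (E ⊗[ℂ] L)} (h : ∀ e, ∀ u ∈ N, e ⊗ₜ u ∈ S) :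
    (tensorSubmodule E N).toSubmodule ≤ S := by
  rintro _ ⟨t, rfl⟩
  let φ := TensorProduct.LieModule.map (LieModuleHom.id : E →ₗ⁅ℂ,𝔨⁆ E) N.incl
  change φ t ∈ S
  induction t using TensorProduct.induction_on with
  | zero => rw [map_zero]; exact S.zero_mem
  | add s t hs ht => rw [map_add]; exact S.add_mem hs ht
  | tmul e u => exact h e u u.2

/-! ### Submodules of `(E ⊗ L)[d]` -/

section EvaluationTensor

variable {𝔤 : Type u} [LieRing 𝔤] [LieAlgebra ℂ 𝔤] {m : ℕ} (a : Fin m → ℂˣ)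
  (V : Fin m → Type v) [∀ i, AddCommGroup (V i)] [∀ i, Module ℂ (V i)]
  [∀ i, LieRingModule 𝔤 (V i)] [∀ i, LieModule ℂ 𝔤 (V i)]

/-- The identification of `V_1 ⊗ ⋯ ⊗ V_m` with the evaluation module. -/
def toEval : (⨂[ℂ] i, V i) ≃ₗ[ℂ] Eval a V := LinearEquiv.refl ℂ (⨂[ℂ] i, V i)

theorem evalHat_single (c : ℂˣ) (k : ℤ) (x : 𝔤) :
    evalHat c (Hat.single k x) = (c : ℂ) ^ k • x := by
  change evalLoop c (AddMonoidAlgebra.single k 1 ⊗ₜ[ℂ] x) = _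
  rw [evalLoop_tmul]
  congr 1
  have h := LaurentPolynomial.eval₂_T (RingHom.id ℂ) c k
  rw [← Units.val_zpow_eq_zpow_val]
  exact h

variable {V} in
theorem lie_single_toEval (k : ℕ) (x : 𝔤) (e : ⨂[ℂ] i, V i) :
    ⁅Hat.single (k : ℤ) x, toEval a V e⁆ =
      ∑ i, (a i : ℂ) ^ k • toEval a V (actAt V i (LieModule.toEnd ℂ 𝔤 (V i) x) e) := by
  simp only [← map_smul, ← map_sum]
  change toEval a V (evalAction a V (Hat.single (k : ℤ) x) e) = _
  congr 1
  simp only [evalAction, evalHat_single, map_smul, actAt_smul, LinearMap.sum_apply,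
    LinearMap.smul_apply, zpow_natCast]

variable (𝔤) (L : Type w) [AddCommGroup L] [Module ℂ L] [LieRingModule (Hat 𝔤) L]
  [LieModule ℂ (Hat 𝔤) L]

/-- The map `E ⊗ (ℂ[X] ⊗ L) → (E ⊗ L)[d]`, `e ⊗ f ⊗ v ↦ f(d) ⊗ e ⊗ v`. -/
def evalInd : (⨂[ℂ] i, V i) ⊗[ℂ] (ℂ[X] ⊗[ℂ] L) →ₗ[ℂ]
    Ind (hatToTilde 𝔤) (Eval a V ⊗[ℂ] L) :=
  polyInd 𝔤 (Eval a V ⊗[ℂ] L) ∘ₗ (TensorProduct.leftComm ℂ (Eval a V) ℂ[X] L).toLinearMap ∘ₗ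
    (toEval a V).toLinearMap.rTensor (ℂ[X] ⊗[ℂ] L)

variable {𝔤 V L}

theorem evalInd_tmul (e : ⨂[ℂ] i, V i) (f : ℂ[X]) (v : L) :
    evalInd 𝔤 a V L (e ⊗ₜ (f ⊗ₜ v)) =
      polyInd 𝔤 (Eval a V ⊗[ℂ] L) (f ⊗ₜ (toEval a V e ⊗ₜ v)) := rfl

variable (𝔤 V L) in
theorem evalInd_surjective : Function.Surjective (evalInd 𝔤 a V L) := by
  have h := LinearMap.rTensor_surjective (ℂ[X] ⊗[ℂ] L) (g := (toEval a V).toLinearMap)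
    (toEval a V).surjective
  exact (polyInd_surjective (𝔤 := 𝔤) (Eval a V ⊗[ℂ] L)).comp
    ((TensorProduct.leftComm ℂ (Eval a V) ℂ[X] L).surjective.comp h)

theorem degreeElement_smul_evalInd (z : (⨂[ℂ] i, V i) ⊗[ℂ] (ℂ[X] ⊗[ℂ] L)) :
    degreeElement 𝔤 • evalInd 𝔤 a V L z = evalInd 𝔤 a V L
      (((LinearMap.mulLeft ℂ (X : ℂ[X])).rTensor L).lTensor (⨂[ℂ] i, V i) z) := by
  rw [evalInd, LinearMap.comp_apply, degreeElement_smul_polyInd]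
  suffices H : (LinearMap.mulLeft ℂ (X : ℂ[X])).rTensor (Eval a V ⊗[ℂ] L) ∘ₗ
      (TensorProduct.leftComm ℂ (Eval a V) ℂ[X] L).toLinearMap ∘ₗ
        (toEval a V).toLinearMap.rTensor (ℂ[X] ⊗[ℂ] L) =
      ((TensorProduct.leftComm ℂ (Eval a V) ℂ[X] L).toLinearMap ∘ₗ
        (toEval a V).toLinearMap.rTensor (ℂ[X] ⊗[ℂ] L)) ∘ₗ
        ((LinearMap.mulLeft ℂ (X : ℂ[X])).rTensor L).lTensor (⨂[ℂ] i, V i) by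
    exact congrArg _ (LinearMap.congr_fun H z)
  refine TensorProduct.ext' fun e y => ?_
  induction y using TensorProduct.induction_on with
  | zero => simp only [TensorProduct.tmul_zero, map_zero]
  | add y y' hy hy' => simp only [TensorProduct.tmul_add, map_add, hy, hy']
  | tmul f v => rfl

/-- For large `k`, the element `x ⊗ t^k` acts on a given element of `(E ⊗ L)[d]` as an exponential
polynomial in `k`. -/
theorem exists_lie_single_evalInd
    (hL : ∀ v : L, ∀ᶠ k : ℕ in Filter.atTop, ∀ y ∈ Hat.current 𝔤 k, ⁅y, v⁆ = 0) (x : 𝔤)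
    (z : (⨂[ℂ] i, V i) ⊗[ℂ] (ℂ[X] ⊗[ℂ] L)) :
    ∃ J₀ K : ℕ, ∀ J ≥ J₀, ∀ k ≥ K,
      ⁅hatToTilde 𝔤 (Hat.single (k : ℤ) x), evalInd 𝔤 a V L z⁆ =
        ∑ i, ∑ j ∈ Finset.range J, ((a i : ℂ) ^ k * (-(k : ℂ)) ^ j) • evalInd 𝔤 a V L
          (TensorProduct.map (actAt V i (LieModule.toEnd ℂ 𝔤 (V i) x))
            ((hasseDeriv j).rTensor L) z) := by
  induction z using TensorProduct.induction_on with
  | zero => exact ⟨0, 0, by simp⟩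
  | add z z' hz hz' =>
    obtain ⟨J, K, h⟩ := hz
    obtain ⟨J', K', h'⟩ := hz'
    refine ⟨max J J', max K K', fun j hj k hk => ?_⟩
    simp only [map_add, lie_add, smul_add, Finset.sum_add_distrib]
    rw [h j (le_of_max_le_left hj) k (le_of_max_le_left hk),
      h' j (le_of_max_le_right hj) k (le_of_max_le_right hk)]
  | tmul e y =>
    induction y using TensorProduct.induction_on with
    | zero => exact ⟨0, 0, by simp⟩
    | add y y' hy hy' =>
      obtain ⟨J, K, h⟩ := hy
      obtain ⟨J', K', h'⟩ := hy'
      refine ⟨max J J', max K K', fun j hj k hk => ?_⟩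
      simp only [TensorProduct.tmul_add, map_add, lie_add, smul_add, Finset.sum_add_distrib]
      rw [h j (le_of_max_le_left hj) k (le_of_max_le_left hk),
        h' j (le_of_max_le_right hj) k (le_of_max_le_right hk)]
    | tmul f v =>
      obtain ⟨K, hK⟩ := (hL v).exists
      -- Beyond the degree of `f` the Taylor expansion has no terms, and from `K` on `x ⊗ t^k` kills
      -- `v`.
      refine ⟨f.natDegree + 1, K, fun J hJ k hk => ?_⟩
      have hv : ⁅Hat.single (k : ℤ) x, v⁆ = 0 := hK _ (Submodule.subset_span ⟨k, x, hk, rfl⟩)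
      rw [evalInd_tmul, lie_single_polyInd, TensorProduct.LieModule.lie_tmul_right, hv,
        TensorProduct.tmul_zero, add_zero, lie_single_toEval, taylor_eq_sum_hasseDeriv hJ]
      simp only [TensorProduct.sum_tmul, TensorProduct.tmul_sum, map_sum,
        TensorProduct.map_tmul, LinearMap.rTensor_tmul, evalInd_tmul, Int.cast_natCast]
      refine Finset.sum_congr rfl fun i _ => Finset.sum_congr rfl fun j _ => ?_
      rw [← TensorProduct.smul_tmul', ← TensorProduct.smul_tmul', TensorProduct.tmul_smul,
        map_smul, map_smul, smul_smul, mul_comm]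

theorem map_actAt_hasseDeriv_mem (ha : Function.Injective a)
    (hL : ∀ v : L, ∀ᶠ k : ℕ in Filter.atTop, ∀ y ∈ Hat.current 𝔤 k, ⁅y, v⁆ = 0)
    {W : LieSubmodule ℂ (Tilde 𝔤) (Ind (hatToTilde 𝔤) (Eval a V ⊗[ℂ] L))}
    {z : (⨂[ℂ] i, V i) ⊗[ℂ] (ℂ[X] ⊗[ℂ] L)} (hz : evalInd 𝔤 a V L z ∈ W) (i : Fin m) (x : 𝔤)
    (j : ℕ) :
    evalInd 𝔤 a V L (TensorProduct.map (actAt V i (LieModule.toEnd ℂ 𝔤 (V i) x))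
      ((hasseDeriv j).rTensor L) z) ∈ W := by
  obtain ⟨J, K, h⟩ := exists_lie_single_evalInd a hL x z
  refine mem_of_sum_pow_mem (a := fun i => (a i : ℂ)) (fun i i' hi => ha (Units.ext hi))
    (fun i => (a i).ne_zero) W.toSubmodule (fun i j => evalInd 𝔤 a V L
      (TensorProduct.map (actAt V i (LieModule.toEnd ℂ 𝔤 (V i) x)) ((hasseDeriv j).rTensor L) z))
    -- Enlarging the range to `max J (j + 1)` keeps the expansion valid and makes the index `j`
    -- available.
    (max J (j + 1)) K (fun k hk => ?_) i (Nat.lt_of_succ_le (le_max_right J (j + 1)))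
  rw [← h _ (le_max_left _ _) k hk]
  exact W.lie_mem hz

end EvaluationTensor

end AffineLie

end

/-! ### The main theorem -/

open AffineLie
theorem theorem3p6
    {𝔤 : Type*} [LieRing 𝔤] [LieAlgebra ℂ 𝔤] [FiniteDimensional ℂ 𝔤] [LieAlgebra.IsSimple ℂ 𝔤]
    (𝔥 : LieSubalgebra ℂ 𝔤) [𝔥.IsCartanSubalgebra]
    (b : (LieAlgebra.IsKilling.rootSystem 𝔥).Base)
    {m : ℕ} (a : Fin m → ℂˣ) (ha : Function.Injective a)
    (l : Fin m → Module.Dual ℂ 𝔥) (hl : l ≠ 0)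
    (V : Fin m → Type*) [∀ i, AddCommGroup (V i)] [∀ i, Module ℂ (V i)]
    [∀ i, LieRingModule 𝔤 (V i)] [∀ i, LieModule ℂ 𝔤 (V i)]
    (hV : ∀ i, IsIrreducibleHighestWeightModule b (V i) (l i))
    (L : Type*) [AddCommGroup L] [Module ℂ L] [LieRingModule (Hat 𝔤) L] [LieModule ℂ (Hat 𝔤) L]
    (hL : ∀ v : L, ∀ᶠ k : ℕ in Filter.atTop, ∀ y ∈ Hat.current 𝔤 k, ⁅y, v⁆ = 0)
    (W : LieSubmodule ℂ (Tilde 𝔤) (Ind (hatToTilde 𝔤) (Eval a V ⊗[ℂ] L))) :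
    ∃ N : LieSubmodule ℂ (Hat 𝔤) L,
      W = Ind.submodule (hatToTilde 𝔤) (tensorSubmodule (Eval a V) N) := by
  have hirr i := (hV i).irreducible
  choose v hv _ using fun i => (hV i).generated
  let Z := W.toSubmodule.comap (evalInd 𝔤 a V L)
  have hmem z : z ∈ Z ↔ evalInd 𝔤 a V L z ∈ W := Iff.rfl
  have hop (i : Fin m) (x : 𝔤) (j : ℕ) z (hz : z ∈ Z) :
      TensorProduct.map (actAt V i (LieModule.toEnd ℂ 𝔤 (V i) x))
        ((Polynomial.hasseDeriv j).rTensor L) z ∈ Z := map_actAt_hasseDeriv_mem a ha hL hz i x j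
  have hZ (i : Fin m) (x : 𝔤) : ∀ z ∈ Z,
      (actAt V i (LieModule.toEnd ℂ 𝔤 (V i) x)).rTensor (Polynomial ℂ ⊗[ℂ] L) z ∈ Z := by
    intro z hz
    have := hop i x 0 z hz
    rwa [Polynomial.hasseDeriv_zero, LinearMap.rTensor_id] at this
  have hX : ∀ y ∈ rightPart Z,
      (LinearMap.mulLeft ℂ (Polynomial.X : Polynomial ℂ)).rTensor L y ∈ rightPart Z := by
    intro y hy
    rw [mem_rightPart] at hy ⊢
    intro e
    rw [← LinearMap.lTensor_tmul, hmem, ← degreeElement_smul_evalInd]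
    exact W.lie_mem (hy e)
  obtain ⟨i, h, hih⟩ : ∃ i h, l i h ≠ 0 := by
    by_contra! H
    exact hl (funext fun i => LinearMap.ext fun h => H i h)
  have hd : ∀ y ∈ rightPart Z,
      (Polynomial.derivative : Polynomial ℂ →ₗ[ℂ] Polynomial ℂ).rTensor L y ∈ rightPart Z := by
    intro y hy
    rw [mem_rightPart] at hy
    refine mem_rightPart_of_tmul_mem hirr hZ (tprod_ne_zero fun i => (hv i).ne_zero) ?_
    -- On the tensor of highest weight vectors, `h` in position `i` acts by the nonzero scalar `l i
    -- h`, leaving only the derivative on `y`.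
    have := hop i (h : 𝔤) 1 _ (hy (PiTensorProduct.tprod ℂ v))
    rw [Polynomial.hasseDeriv_one, TensorProduct.map_tmul, actAt_tprod, LieModule.toEnd_apply_apply,
      (hv i).cartan, MultilinearMap.map_update_smul, Function.update_eq_self,
      ← TensorProduct.smul_tmul', Submodule.smul_mem_iff _ hih] at this
    exact this
  let N : LieSubmodule ℂ (Hat 𝔤) L :=
    { (rightPart Z).comap (TensorProduct.mk ℂ (Polynomial ℂ) L 1) with
      lie_mem := by
        intro y u hu
        change (1 : Polynomial ℂ) ⊗ₜ ⁅y, u⁆ ∈ rightPart Z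
        replace hu : (1 : Polynomial ℂ) ⊗ₜ u ∈ rightPart Z := hu
        rw [mem_rightPart] at hu ⊢
        intro e
        -- By the Leibniz rule this is `1 ⊗ ye ⊗ u + 1 ⊗ e ⊗ yu`. The first term is in `W` because
        -- `e` was arbitrary in `hu`, so the second is too.
        have h1 := W.lie_mem (x := hatToTilde 𝔤 y) (hu e)
        have h2 := hu ((toEval a V).symm ⁅y, toEval a V e⁆)
        rw [hmem, evalInd_tmul, LinearEquiv.apply_symm_apply] at h2
        rw [evalInd_tmul, lie_polyInd_one_tmul, TensorProduct.LieModule.lie_tmul_right,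
          TensorProduct.tmul_add, map_add] at h1
        exact (W.toSubmodule.add_mem_iff_right h2).1 h1 }
  have hN u : u ∈ N ↔ (1 : Polynomial ℂ) ⊗ₜ u ∈ rightPart Z := Iff.rfl
  have hEN (e : Eval a V) {u : L} (hu : u ∈ N) : e ⊗ₜ u ∈ tensorSubmodule (Eval a V) N :=
    ⟨e ⊗ₜ ⟨u, hu⟩, rfl⟩
  refine ⟨N, le_antisymm ?_ (submodule_le ?_)⟩
  · intro w hw
    obtain ⟨z, rfl⟩ := evalInd_surjective 𝔤 a V L w
    refine (Submodule.span_le (p := (Ind.submodule (hatToTilde 𝔤)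
      (tensorSubmodule (Eval a V) N)).toSubmodule.comap (evalInd 𝔤 a V L))).2 ?_
      (mem_span_tmul_rightPart hirr hZ (z := z) hw)
    rintro _ ⟨e, y, hy, rfl⟩
    obtain ⟨u, n, rfl⟩ := exists_eq_sum_X_pow_tmul y
    rw [TensorProduct.tmul_sum]
    refine Submodule.sum_mem _ fun k hk => ?_
    exact mem_submodule_of_mem
      (hEN _ (one_tmul_mem_of_sum_mem hX hd hy (Finset.mem_range.1 hk))) _
  · intro t ht f
    refine (tensorSubmodule_le (S := W.toSubmodule.comap
      (polyInd 𝔤 (Eval a V ⊗[ℂ] L) ∘ₗ TensorProduct.mk ℂ _ _ f)) fun e u hu => ?_) ht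
    have hfu : f ⊗ₜ u ∈ rightPart Z := by
      rw [f.as_sum_range_C_mul_X_pow, TensorProduct.sum_tmul]
      refine Submodule.sum_mem _ fun k _ => ?_
      rw [← Polynomial.smul_eq_C_mul, ← TensorProduct.smul_tmul']
      exact Submodule.smul_mem _ _ (X_pow_tmul_mem hX hu k)
    have h := mem_rightPart.1 hfu ((toEval a V).symm e)
    rw [hmem, evalInd_tmul, LinearEquiv.apply_symm_apply] at h
    exact h
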